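/- Let $m>2$, $m\neq 6$, let $\mathbb M=\mathbb F_{2^m}$ and $\mathbb F=\mathbb M\times\mathbb M$. Let $p$ be a $2$-primitive divisor, i.e. a prime dividing $2^m-1$ but no $2^i-1$ with $0<i<m$, and let $P$ be the Sylow $p$-subgroup of $\mathbb M^\times$. For $q=2^k$, $r=2^l$ with $k,l\ge 0$ write $(a,b,c,d)_q=ax^{q+1}+bx^qy+cxy^q+dy^{q+1}$; a $(q,r)$-biprojective polynomial pair is a map $F:\mathbb F\to\mathbb F$ of the form $F(x,y)=[(a_0,b_0,c_0,d_0)_q,(a_1,b_1,c_1,d_1)_r]$ with coefficients in $\mathbb M$. Let $\mathrm{Aut}_{EL}(F)$ be the group of all $\mathbb F_2$-linear bijections of $\mathbb F\times\mathbb F$ of block form $\begin{pmatrix} M&0\\N&L\end{pmatrix}$ that map the graph $\{(v,F(v)):v\in\mathbb F\}$ onto itself. For $a\in\mathbb M$ let $m_a$ denote multiplication by $a$ on $\mathbb M$, and put $$Z^{(q,r)}=\{\mathrm{diag}(m_a,m_a,m_{a^{q+1}},m_{a^{r+1}}): a\in\mathbb M^\times\},\qquad Z_P^{(q,r)}=\{\mathrm{diag}(m_a,m_a,m_{a^{q+1}},m_{a^{r+1}}):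 a\in P\}.$$ Let $C_F$ be the centralizer of $Z_P^{(q,r)}$ in $\mathrm{Aut}_{EL}(F)$. Condition (C) says that $C_F$ contains $Z^{(q,r)}$ as a subgroup of an index $I$ with $p\nmid I$. The families are the following, each with its pair $(q,r)=(2^k,2^l)$. - Carlet: $q=1$ ($k=0$), $r=2^l$, $0<l<m$, $\gcd(l,m)=1$, $F=[xy,(1,b,c,d)_r]$, where $x^{r+1}+bx^r+cx+d\ne0$ for all $x\in\mathbb M$. - Taniguchi: $r=q^2$ ($l=2k$), $0<k<m$, $\gcd(k,m)=1$, $F=[(1,0,1,d)_q,(0,0,1,0)_{q^2}]$, where $x^{q+1}+x+d\neq0$ for all $x\in\mathbb M$. - Zhou–Pott (with $j=l\neq 0$): $0<k,l<m$, $m$ even, $\gcd(k,m)=1$, $F=[(1,0,0,d)_q,(0,0,1,0)_r]$, where $d\neq a^{q+1}(b^q+b)^{1-r}$ for all $a,b\in\mathbb M$ (with the convention $0^{1-r}=0$, $r>1$). - $\mathcal F_1$: $r=q^2$ ($l=2k$), $0<k<m$, $\gcd(3k,m)=1$, $F=[(1,0,1,1)_q,(1,1,0,1)_{q^2}]$.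 - $\mathcal F_2$: $r=q^3$ ($l=3k$), $0<k<m$, $\gcd(3k,m)=1$, $m$ odd, $F=[(1,0,1,1)_q,(0,1,1,0)_{q^3}]$. - $\mathcal F_4$: $r=2^{k+m/2}$ ($l=k+m/2$), $0<k<m$, $m\equiv2\pmod 4$, $\gcd(k,m)=1$, $F=[(1,0,0,B)_q,(0,1,a/B,0)_r]$, where $a\in\mathbb F_{2^{m/2}}^\times$, $B\in\mathbb M^\times$ is not a cube, and $B^{q+r}\ne a^{q+1}$. **Lemma.** Let $F$ be a $(q=2^k,r=2^l)$-biprojective polynomial pair with $l\notin\{0,m/2\}$ and $k\not\equiv\pm l\pmod m$. 1. If $F$ is a Zhou–Pott function with $j\neq 0$ or belongs to $\mathcal F_4$, then $C_F=\bigcup_{\omega\in\mathbb F_4^\times}Z_\omega^{(q,r)}$, where $Z_\omega^{(q,r)}=\{\mathrm{diag}(m_a,m_{a\omega},m_{a^{q+1}},m_{a^{r+1}\omega^r}):a\in\mathbb M^\times\}$. (Moreover $Z_1^{(q,r)}=Z^{(q,r)}$.) 2. If $F$ is a Taniguchi function, then $C_F=Z^{(q,r)}$. 3. If $F$ belongs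 to $\mathcal F_1$ or $\mathcal F_2$, then $C_F=Z^{(q,r)}\cup A\cup B$, where $$A=\left\{\begin{pmatrix} m_a&m_a&0&0\\ m_a&0&0&0\\ 0&0&m_{a^{q+1}}&0\\ 0&0&0&m_{a^{r+1}}\end{pmatrix}:a\in\mathbb M^\times\right\},\qquad B=\left\{\begin{pmatrix} 0&m_a&0&0\\ m_a&m_a&0&0\\ 0&0&m_{a^{q+1}}&0\\ 0&0&0&m_{a^{r+1}}\end{pmatrix}:a\in\mathbb M^\times\right\}.$$ 4. If $F$ is a Carlet function and $m$ is odd, then $C_F$ contains $Z^{(q,r)}$ as a subgroup of index $3$. In all these cases $C_F=Z^{(q,r)}$, or $Z^{(q,r)}$ is a subgroup of index $3$ of $C_F$; in particular $p$ does not divide the index, and condition (C) holds. -/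

import Mathlib

namespace BiprojAPN

/-- `p` is a `2`-primitive divisor: a prime dividing `2 ^ m - 1` but no `2 ^ i - 1` with
`0 < i < m`. -/
def IsPrimitiveDivisor (m p : ℕ) : Prop :=
  p.Prime ∧ p ∣ 2 ^ m - 1 ∧ ∀ i : ℕ, 0 < i → i < m → ¬ p ∣ 2 ^ i - 1

section Polynomials

variable {M : Type*} [Field M]

/-- The `2 ^ k`-biprojective polynomial `(a, b, c, d)_q` with `q = 2 ^ k`, that is
`a x^(q+1) + b x^q y + c x y^q + d y^(q+1)`, as a function. -/
def biproj (k : ℕ) (a b c d : M) (x y : M) : M :=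
  a * x ^ (2 ^ k + 1) + b * (x ^ 2 ^ k * y) + c * (x * y ^ 2 ^ k) + d * y ^ (2 ^ k + 1)

/-- `F` is a `(2 ^ k, 2 ^ l)`-biprojective polynomial pair. -/
def IsBiprojectivePair (k l : ℕ) (F : M × M → M × M) : Prop :=
  ∃ a₀ b₀ c₀ d₀ a₁ b₁ c₁ d₁ : M,
    F = fun v => (biproj k a₀ b₀ c₀ d₀ v.1 v.2, biproj l a₁ b₁ c₁ d₁ v.1 v.2)

/-! The families of APN functions on `M × M`, where `M` has `2 ^ m` elements, together with the
exponents `k`, `l` for which they are `(2 ^ k, 2 ^ l)`-biprojective. -/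

/-- Carlet functions `[xy, (1, b, c, d)_r]`, `r = 2 ^ l`; they are `(1, r)`-biprojective. -/
def IsCarlet (m k l : ℕ) (F : M × M → M × M) : Prop :=
  k = 0 ∧ 0 < l ∧ l < m ∧ Nat.gcd l m = 1 ∧
  ∃ b c d : M, (∀ x : M, x ^ (2 ^ l + 1) + b * x ^ 2 ^ l + c * x + d ≠ 0) ∧
    F = fun v => (v.1 * v.2, biproj l 1 b c d v.1 v.2)

/-- Taniguchi functions `[(1, 0, 1, d)_q, (0, 0, 1, 0)_{q^2}]`. -/
def IsTaniguchi (m k l : ℕ) (F : M × M → M × M) : Prop :=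
  0 < k ∧ k < m ∧ Nat.gcd k m = 1 ∧ l = 2 * k ∧
  ∃ d : M, (∀ x : M, x ^ (2 ^ k + 1) + x + d ≠ 0) ∧
    F = fun v => (biproj k 1 0 1 d v.1 v.2, biproj l 0 0 1 0 v.1 v.2)

/-- Zhou-Pott functions `[(1, 0, 0, d)_q, (0, 0, 1, 0)_r]`, `r = 2 ^ l`, with `l ≠ 0`. -/
def IsZhouPott (m k l : ℕ) (F : M × M → M × M) : Prop :=
  0 < k ∧ k < m ∧ 0 < l ∧ l < m ∧ Even m ∧ Nat.gcd k m = 1 ∧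
  ∃ d : M, (∀ a b : M, d ≠ a ^ (2 ^ k + 1) * (b ^ 2 ^ k + b) ^ (1 - (2 : ℤ) ^ l)) ∧
    F = fun v => (biproj k 1 0 0 d v.1 v.2, biproj l 0 0 1 0 v.1 v.2)

/-- The family `F_1`: `[(1, 0, 1, 1)_q, (1, 1, 0, 1)_{q^2}]`. -/
def IsFamily1 (m k l : ℕ) (F : M × M → M × M) : Prop :=
  0 < k ∧ k < m ∧ Nat.gcd (3 * k) m = 1 ∧ l = 2 * k ∧
    F = fun v => (biproj k 1 0 1 1 v.1 v.2, biproj l 1 1 0 1 v.1 v.2)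

/-- The family `F_2`: `[(1, 0, 1, 1)_q, (0, 1, 1, 0)_{q^3}]`. -/
def IsFamily2 (m k l : ℕ) (F : M × M → M × M) : Prop :=
  0 < k ∧ k < m ∧ Nat.gcd (3 * k) m = 1 ∧ Odd m ∧ l = 3 * k ∧
    F = fun v => (biproj k 1 0 1 1 v.1 v.2, biproj l 0 1 1 0 v.1 v.2)

/-- The family `F_4`: `[(1, 0, 0, B)_q, (0, 1, a / B, 0)_r]` with `r = 2 ^ (k + m / 2)`, where `a`
is a nonzero element of the subfield with `2 ^ (m / 2)` elements and `B` is not a cube. -/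
def IsFamily4 (m k l : ℕ) (F : M × M → M × M) : Prop :=
  0 < k ∧ k < m ∧ m % 4 = 2 ∧ Nat.gcd k m = 1 ∧ l = k + m / 2 ∧
  ∃ a B : M, a ≠ 0 ∧ a ^ 2 ^ (m / 2) = a ∧ B ≠ 0 ∧ (¬ ∃ c : M, c ^ 3 = B) ∧
    B ^ (2 ^ k + 2 ^ l) ≠ a ^ (2 ^ k + 1) ∧
    F = fun v => (biproj k 1 0 0 B v.1 v.2, biproj l 0 1 (a / B) 0 v.1 v.2)

end Polynomials

section Groups

variable (M : Type*) [Field M] [Algebra (ZMod 2) M]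

/-- `GL(F × F)` for `F = M × M`: the `F_2`-linear bijections. -/
abbrev GLFF : Type _ :=
  ((M × M) × (M × M)) ≃ₗ[ZMod 2] ((M × M) × (M × M))

variable {M}

/-- `A` is a block matrix `(S 0; N L)` with respect to `F × F`. -/
def IsELMap (A : GLFF M) : Prop :=
  ∃ S N L : (M × M) →ₗ[ZMod 2] (M × M), ∀ u v : M × M, A (u, v) = (S u, N u + L v)

theorem IsELMap.inv [Finite M] {A : GLFF M} (hA : IsELMap A) : IsELMap A⁻¹ := by
  obtain ⟨S, N, L, h⟩ := hA
  have hinj : Function.Injective L := by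
    intro v w hvw
    have : A (0, v) = A (0, w) := by rw [h, h, hvw]
    simpa using A.injective this
  have hsurj : Function.Surjective L := Finite.injective_iff_surjective.mp hinj
  have key : ∀ v : M × M, (A⁻¹ (0, v)).1 = 0 := by
    intro v
    obtain ⟨w, rfl⟩ := hsurj v
    have h1 : A (0, w) = (0, L w) := by simp [h]
    rw [← h1]
    have h2 : A⁻¹ (A (0, w)) = (0, w) := A.symm_apply_apply _
    rw [h2]
  refine ⟨LinearMap.fst _ _ _ ∘ₗ (A⁻¹).toLinearMap ∘ₗ LinearMap.inl _ _ _,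
    LinearMap.snd _ _ _ ∘ₗ (A⁻¹).toLinearMap ∘ₗ LinearMap.inl _ _ _,
    LinearMap.snd _ _ _ ∘ₗ (A⁻¹).toLinearMap ∘ₗ LinearMap.inr _ _ _, fun u v => ?_⟩
  have h3 : ((u, v) : (M × M) × (M × M)) = (u, 0) + (0, v) := by simp
  rw [h3, map_add]
  ext1
  · simpa using key v
  · simp

variable (M) in
/-- The group of EL-mappings. -/
def ELM [Finite M] : Subgroup (GLFF M) where
  carrier := {A | IsELMap A}
  one_mem' := ⟨LinearMap.id, 0, LinearMap.id, fun u v => by simp⟩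
  mul_mem' := by
    rintro A B ⟨S, N, L, h⟩ ⟨S', N', L', h'⟩
    refine ⟨S ∘ₗ S', N ∘ₗ S' + L ∘ₗ N', L ∘ₗ L', fun u v => ?_⟩
    rw [LinearEquiv.mul_apply, h', h]
    simp [add_assoc]
  inv_mem' := fun hA => IsELMap.inv hA

/-- The graph `Γ_F = {(x, F x)}`. -/
def graph (F : M × M → M × M) : Set ((M × M) × (M × M)) :=
  Set.range fun v => (v, F v)

/-- The group of EL-automorphisms of `F`. -/
def AutEL [Finite M] (F : M × M → M × M) : Subgroup (GLFF M) where
  carrier := {A | A ∈ ELM M ∧ A '' graph F = graph F}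
  one_mem' := ⟨one_mem _, by simp⟩
  mul_mem' := by
    rintro A B ⟨hA, hA'⟩ ⟨hB, hB'⟩
    refine ⟨mul_mem hA hB, ?_⟩
    have : (⇑(A * B) : _ → _) = A ∘ B := rfl
    rw [this, Set.image_comp, hB', hA']
  inv_mem' := by
    rintro A ⟨hA, hA'⟩
    refine ⟨inv_mem hA, ?_⟩
    have h : (⇑A⁻¹ : _ → _) ∘ A = id := funext fun x => A.symm_apply_apply x
    conv_lhs => rw [← hA']
    rw [← Set.image_comp, h, Set.image_id]

/-- The diagonal matrix `diag(m_a, m_b, m_c, m_d)`, where `m_a` is the multiplication `x ↦ a x`. -/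
def diag (a b c d : Mˣ) : GLFF M :=
  ((DistribMulAction.toModuleAut (ZMod 2) M a).prodCongr
    (DistribMulAction.toModuleAut (ZMod 2) M b)).prodCongr
  ((DistribMulAction.toModuleAut (ZMod 2) M c).prodCongr
    (DistribMulAction.toModuleAut (ZMod 2) M d))

theorem diag_apply (a b c d : Mˣ) (x y z w : M) :
    diag a b c d ((x, y), (z, w)) = ((a * x, b * y), (c * z, d * w)) := rfl

/-- The homomorphism `a ↦ diag(m_a, m_a, m_{a^(q+1)}, m_{a^(r+1)})`, `q = 2 ^ k`, `r = 2 ^ l`. -/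
def zHom (k l : ℕ) : Mˣ →* GLFF M where
  toFun a := diag a a (a ^ (2 ^ k + 1)) (a ^ (2 ^ l + 1))
  map_one' := by
    ext1 ⟨⟨x, y⟩, ⟨z, w⟩⟩
    simp [diag_apply]
  map_mul' a b := by
    ext1 ⟨⟨x, y⟩, ⟨z, w⟩⟩
    rw [LinearEquiv.mul_apply]
    simp only [diag_apply, mul_pow, Units.val_mul, mul_assoc]

variable (M) in
/-- The group `Z^(q,r)`, `q = 2 ^ k`, `r = 2 ^ l`. -/
def Z (k l : ℕ) : Subgroup (GLFF M) := (zHom k l).range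

/-- The group `Z_P^(q,r)` of the matrices of `Z^(q,r)` with `a ∈ P`. -/
def ZP (P : Subgroup Mˣ) (k l : ℕ) : Subgroup (GLFF M) := P.map (zHom k l)

/-- The centralizer `C_F` of `Z_P^(q,r)` in `Aut_EL(F)`. -/
def CF [Finite M] (P : Subgroup Mˣ) (k l : ℕ) (F : M × M → M × M) : Subgroup (GLFF M) :=
  Subgroup.centralizer (ZP P k l : Set (GLFF M)) ⊓ AutEL F

/-- Condition (C): `C_F` contains `Z^(q,r)` as a subgroup of an index not divisible by `p`. -/
def ConditionC [Finite M] (p : ℕ) (P : Subgroup Mˣ) (k l : ℕ) (F : M × M → M × M) : Prop :=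
  Z M k l ≤ CF P k l F ∧ ¬ p ∣ (Z M k l).relIndex (CF P k l F)

variable (M) in
/-- The nonzero elements of the subfield of `M` with four elements (for even `m`). -/
def F4Units : Set Mˣ := {ω | (ω : M) ^ 4 = ω}

/-- The set `Z_ω^(q,r) = {diag(m_a, m_{aω}, m_{a^(q+1)}, m_{a^(r+1) ω^r})}`. -/
def Zω (k l : ℕ) (ω : Mˣ) : Set (GLFF M) :=
  {T | ∃ a : Mˣ, T = diag a (a * ω) (a ^ (2 ^ k + 1)) (a ^ (2 ^ l + 1) * ω ^ 2 ^ l)}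

variable (M) in
/-- The set of the matrices with upper left block `(m_a m_a; m_a 0)`, lower right block
`diag(m_{a^(q+1)}, m_{a^(r+1)})` and zeros elsewhere. -/
def setA (k l : ℕ) : Set (GLFF M) :=
  {T | ∃ a : Mˣ, ∀ x y z w : M, T ((x, y), (z, w)) =
    ((a * x + a * y, a * x), (a ^ (2 ^ k + 1) * z, a ^ (2 ^ l + 1) * w))}

variable (M) in
/-- The set of the matrices with upper left block `(0 m_a; m_a m_a)`, lower right block
`diag(m_{a^(q+1)}, m_{a^(r+1)})` and zeros elsewhere. -/
def setB (k l : ℕ) : Set (GLFF M) :=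
  {T | ∃ a : Mˣ, ∀ x y z w : M, T ((x, y), (z, w)) =
    ((a * y, a * x + a * y), (a ^ (2 ^ k + 1) * z, a ^ (2 ^ l + 1) * w))}

end Groups

end BiprojAPN

open BiprojAPN

/-! ### Linear maps as combinations of Galois automorphisms -/

section GaloisCoefficients

/-! Let `φ`, `ψ` be the `q`- and `r`-Frobenius, so that the components of `F` are a `φ`- and a
`ψ`-twisted quadratic form. An element of `P` of order `p` generates `M` over `F_2`, because `p` is
primitive. Commuting with `Z_P` therefore forces the upper left block of an element of `C_F` to be a
2×2 matrix `S` over `M` (`exists_of_mem_CF`), and `F ∘ S = N + L ∘ F` with `N`, `L` merely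
`F_2`-linear.

By Dedekind independence, `F_2`-linear maps are unique combinations of automorphisms, and the
monomials `g(x) h(y)` can be compared coefficientwise. Since `φ ≠ ψ` and `φψ ≠ 1`, the two
components cannot interact: `S` sends a component with leading coefficient 1 to a multiple of
itself, provided its automorphism has nontrivial square (`twistedForm_semi_invariant`). The same
comparison shows that the graph of `F` satisfies no linear relation, so an element of `C_F` is
determined by `S` (`eq_of_hasBlock`). It remains to find the possible `S`.

For `F_1`, `F_2` and Carlet, one component is a form without roots, written as `det(v, Hφ(v))` with
its own automorphism in the role of `φ`. After scaling, `S` commutes with the semilinear map `v ↦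
Hφ(v)`. Nonzero commuting matrices have determinant 1, and applying this to `S` and `S + 1` gives
trace 1 unless `S = 1`. Hence they lie in `{1, T, T + 1}`, the nonzero part of a four-element field,
which gives three cosets of `Z`. The matrix `T` is explicit for `F_1`, `F_2`; for Carlet it is an
iterate of the semilinear map.

For Taniguchi, Zhou–Pott and `F_4`, the second component vanishes at the columns of `S`, so `S` is
diagonal or antidiagonal. The first component excludes the antidiagonal case and makes the ratio of
the diagonal entries 1 or a cube root of unity. -/

open scoped Classical in
/-- Every `K`-linear endomorphism of a Galois extension is a combination of automorphisms. -/
theorem exists_galois_coeff {K M : Type*} [Field K] [Field M] [Algebra K M]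
    [FiniteDimensional K M] [IsGalois K M] (L : M →ₗ[K] M) :
    ∃ c : Gal(M/K) → M, ∀ x, L x = ∑ g, c g * g x := by
  have hli : LinearIndependent M (fun g : Gal(M/K) => (g : M →ₐ[K] M).toLinearMap) :=
    (linearIndependent_toLinearMap K M M).comp _ fun g h hgh =>
      AlgEquiv.ext fun x => DFunLike.congr_fun hgh x
  have hcard : Fintype.card Gal(M/K) = Module.finrank M (M →ₗ[K] M) := by
    rw [Module.finrank_linearMap_self, ← IsGalois.card_aut_eq_finrank, Nat.card_eq_fintype_card]
  have hspan := hli.span_eq_top_of_card_eq_finrank' hcard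
  have hL : L ∈ Submodule.span M
      (Set.range fun g : Gal(M/K) => (g : M →ₐ[K] M).toLinearMap) := hspan ▸ Submodule.mem_top
  obtain ⟨c, hc⟩ := (Submodule.mem_span_range_iff_exists_fun M).1 hL
  refine ⟨c, fun x => ?_⟩
  rw [← hc]
  simp

/-- The monomials `g x`, for automorphisms `g`, are linearly independent. -/
theorem galois_coeff_eq_zero {K M : Type*} [Field K] [Field M] [Algebra K M]
    [Fintype Gal(M/K)] {c : Gal(M/K) → M} (h : ∀ x, ∑ g, c g * g x = 0) (g : Gal(M/K)) :
    c g = 0 := by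
  have hli : LinearIndependent M (fun g : Gal(M/K) => ((g : M →* M) : M → M)) :=
    (linearIndependent_monoidHom M M).comp _ fun g h hgh =>
      AlgEquiv.ext fun x => DFunLike.congr_fun hgh x
  refine Fintype.linearIndependent_iff.1 hli c (funext fun x => ?_) g
  simpa using h x

/-- The monomials `g x * h y`, for automorphisms `g`, `h`, are linearly independent. -/
theorem galois_bilin_coeff_eq {K M : Type*} [Field K] [Field M] [Algebra K M]
    [Fintype Gal(M/K)] {C D : Gal(M/K) → Gal(M/K) → M}
    (h : ∀ x y, ∑ g, ∑ k, C g k * (g x * k y) = ∑ g, ∑ k, D g k * (g x * k y)) (g k : Gal(M/K)) :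
    C g k = D g k := by
  have h1 : ∀ x y, ∑ k, (∑ g, (C g k - D g k) * g x) * k y = 0 := by
    intro x y
    simp_rw [Finset.sum_mul]
    rw [Finset.sum_comm]
    have h' := sub_eq_zero.2 (h x y)
    rw [← Finset.sum_sub_distrib] at h'
    rw [← h']
    refine Finset.sum_congr rfl fun g _ => ?_
    rw [← Finset.sum_sub_distrib]
    exact Finset.sum_congr rfl fun k _ => by ring
  exact sub_eq_zero.1
    (galois_coeff_eq_zero (fun x => galois_coeff_eq_zero (fun y => h1 x y) k) g)

open scoped Classical in
/-- Comparison of the coefficients of the monomials `g x * h y` in a relation between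
`φ`-bilinear and `ψ`-bilinear forms. -/
theorem galois_relation_coeff {K M : Type*} [Field K] [Field M] [Algebra K M]
    [FiniteDimensional K M] [IsGalois K M] {φ ψ : Gal(M/K)} {L L' : M →ₗ[K] M}
    {P Q b c b' c' : M}
    (H : ∀ x y, P * (φ x * y) + Q * (x * φ y) = L (b * (φ x * y) + c * (x * φ y)) +
      L' (b' * (ψ x * y) + c' * (x * ψ y))) :
    ∃ u u' : Gal(M/K) → M, (∀ x, L x = ∑ g, u g * g x) ∧ (∀ x, L' x = ∑ g, u' g * g x) ∧
      ∀ g h : Gal(M/K),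
        (if g = φ ∧ h = 1 then P else 0) + (if g = 1 ∧ h = φ then Q else 0) =
          (if g = h * φ then u h * h b else 0) + (if h = g * φ then u g * g c else 0) +
          (if g = h * ψ then u' h * h b' else 0) + (if h = g * ψ then u' g * g c' else 0) := by
  obtain ⟨u, hu⟩ := exists_galois_coeff L
  obtain ⟨u', hu'⟩ := exists_galois_coeff L'
  refine ⟨u, u', hu, hu', galois_bilin_coeff_eq fun x y => ?_⟩
  have e1 : ∀ (s : Gal(M/K)) (w : Gal(M/K) → M), ∑ g : Gal(M/K), ∑ h : Gal(M/K),
      (if g = h * s then w h else 0) * (g x * h y) = ∑ h, w h * (h (s x) * h y) := by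
    intro s w
    rw [Finset.sum_comm]
    refine Finset.sum_congr rfl fun h _ => ?_
    simp [ite_mul]
  have e2 : ∀ (s : Gal(M/K)) (w : Gal(M/K) → M), ∑ g : Gal(M/K), ∑ h : Gal(M/K),
      (if h = g * s then w g else 0) * (g x * h y) = ∑ g, w g * (g x * g (s y)) := by
    intro s w
    refine Finset.sum_congr rfl fun h _ => ?_
    simp [ite_mul]
  have e3 : ∀ (s t : Gal(M/K)) (w : M), ∑ g : Gal(M/K), ∑ h : Gal(M/K),
      (if g = s ∧ h = t then w else 0) * (g x * h y) = w * (s x * t y) := by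
    intro s t w
    simp [ite_and, ite_mul]
  simp only [add_mul, Finset.sum_add_distrib]
  rw [e3, e3, e1 φ fun h => u h * h b, e1 ψ fun h => u' h * h b', e2 φ fun h => u h * h c,
    e2 ψ fun h => u' h * h c']
  simp only [AlgEquiv.one_apply]
  rw [H, map_add, map_add, hu, hu, hu', hu']
  simp only [map_mul]
  simp only [← add_assoc, mul_assoc]

end GaloisCoefficients

/-! ### Substitutions in twisted forms and comparison of coefficients -/

section TwistedForms

variable {K M : Type*} [Field K] [Field M] [Algebra K M]

/-- The form `a φ(x) x + b φ(x) y + c x φ(y) + d φ(y) y` twisted by the automorphism `φ`. -/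
def twistedForm (φ : Gal(M/K)) (a b c d x y : M) : M :=
  a * (φ x * x) + b * (φ x * y) + c * (x * φ y) + d * (φ y * y)

/-- The coefficient of `φ(x) y` after a linear substitution in `twistedForm φ a b c d`. -/
def crossL (φ : Gal(M/K)) (a b c d α β γ δ : M) : M :=
  a * (φ α * β) + b * (φ α * δ) + c * (φ γ * β) + d * (φ γ * δ)

/-- The coefficient of `x φ(y)` after a linear substitution in `twistedForm φ a b c d`. -/
def crossR (φ : Gal(M/K)) (a b c d α β γ δ : M) : M :=
  a * (α * φ β) + b * (γ * φ β) + c * (α * φ δ) + d * (γ * φ δ)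

theorem twistedForm_subst (φ : Gal(M/K)) (a b c d α β γ δ x y : M) :
    twistedForm φ a b c d (α * x + β * y) (γ * x + δ * y) =
      twistedForm φ (twistedForm φ a b c d α γ) (crossL φ a b c d α β γ δ)
        (crossR φ a b c d α β γ δ) (twistedForm φ a b c d β δ) x y := by
  simp only [twistedForm, crossL, crossR, map_add, map_mul]
  ring

variable [FiniteDimensional K M] [IsGalois K M] {φ ψ : Gal(M/K)}

/-- Expanding `L`, the right side contains only monomials `g(x) h(y)` with `g = hψ` or `h = gψ`, and
neither `φ(x) y` nor `x φ(y)` is of this kind. This keeps the second component out of the first. -/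
theorem bilin_eq_zero_of_mem_twist (h1 : φ ≠ 1) (h2 : φ ≠ ψ) (h3 : φ * ψ ≠ 1) {P Q b c : M}
    {L : M →ₗ[K] M}
    (H : ∀ x y, P * (φ x * y) + Q * (x * φ y) = L (b * (ψ x * y) + c * (x * ψ y))) :
    P = 0 ∧ Q = 0 := by
  obtain ⟨u, u', -, -, h⟩ := galois_relation_coeff (φ := φ) (ψ := ψ) (L := 0) (L' := L)
    (P := P) (Q := Q) (b := 0) (c := 0) (b' := b) (c' := c) (by simpa using H)
  have hA := h φ 1
  have hB := h 1 φ
  simp only [one_mul, h2, h1, Ne.symm h3, if_true, if_false, and_self, and_false, false_and,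
    map_zero, mul_zero, ite_self, add_zero, zero_add] at hA hB
  exact ⟨hA, hB⟩

/-- At the monomial `g(x) (gφ)(y)` the hypotheses on `φ`, `ψ` leave only the coefficient of `g` in
`L` on the right, while the left side contributes only for `g = 1`. -/
theorem linear_eq_mul_of_polar (h1 : φ * φ ≠ 1) (h2 : φ ≠ ψ) (h3 : φ * ψ ≠ 1) {t a : M}
    {L L' : M →ₗ[K] M}
    (H : ∀ x y, t * (φ x * y) + t * (x * φ y) =
      L (1 * (φ x * y) + 1 * (x * φ y)) + L' (a * (ψ x * y) + a * (x * ψ y))) (z : M) :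
    L z = t * z := by
  classical
  obtain ⟨u, u', hu, -, h⟩ := galois_relation_coeff H
  have key : ∀ g, u g = if g = 1 then t else 0 := by
    intro g
    have hg := h g (g * φ)
    have e1 : ¬ (g = φ ∧ g * φ = 1) := by
      rintro ⟨hg, hg'⟩
      exact h1 (hg ▸ hg' : φ * φ = 1)
    have e2 : g ≠ g * φ * φ := by rw [mul_assoc]; simpa using h1
    have e3 : g ≠ g * φ * ψ := by rw [mul_assoc]; simpa using h3
    have e4 : g * φ ≠ g * ψ := by simpa using h2
    have e5 : (g = 1 ∧ g * φ = φ) ↔ g = 1 := by simp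
    simp only [e1, e2, e3, e4, e5, if_false, if_true, zero_add, add_zero, map_one, mul_one] at hg
    exact hg.symm
  rw [hu]
  simp [key]

/-- The monomials `g(x) (gφ)(y)` and `(gφ)(x) g(y)` isolate the coefficient of `g` in `L`, unless
`φ² = 1` and both terms are present. The alternative `b = 0` or `c = 0` also admits `φ = 1`, needed
for the component `xy`. -/
theorem linear_eq_zero_of_bilin {b c : M} (h0 : b ≠ 0 ∨ c ≠ 0)
    (h1 : b = 0 ∨ c = 0 ∨ φ * φ ≠ 1) {L : M →ₗ[K] M}
    (H : ∀ x y, L (b * (φ x * y) + c * (x * φ y)) = 0) : L = 0 := by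
  classical
  obtain ⟨u, u', hu, -, h⟩ := galois_relation_coeff (φ := φ) (ψ := 1) (L := L) (L' := 0)
    (P := 0) (Q := 0) (b := b) (c := c) (b' := 0) (c' := 0) (by simpa using fun x y => (H x y).symm)
  have key : ∀ g, u g = 0 := by
    intro g
    have hA := h g (g * φ)
    have hB := h (g * φ) g
    simp only [ite_self, map_zero, mul_zero, add_zero, if_true] at hA hB
    rcases h0 with h0 | h0
    · have hc : (if g = g * φ * φ then u (g * φ) * (g * φ) c else 0) = 0 := by
        rcases h1 with h1 | h1 | h1
        · exact absurd h1 h0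
        · simp [h1]
        · rw [if_neg (by rw [mul_assoc]; simpa using h1)]
      rw [hc, add_zero] at hB
      exact (mul_eq_zero.1 hB.symm).resolve_right (by simpa using h0)
    · have hb : (if g = g * φ * φ then u (g * φ) * (g * φ) b else 0) = 0 := by
        rcases h1 with h1 | h1 | h1
        · simp [h1]
        · exact absurd h1 h0
        · rw [if_neg (by rw [mul_assoc]; simpa using h1)]
      rw [hb, zero_add] at hA
      exact (mul_eq_zero.1 hA.symm).resolve_right (by simpa using h0)
  ext x
  rw [hu]
  simp [key]

/-- If a substitution maps a `φ`-twisted form `f`, with leading coefficient `1`, to a linear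
expression in `f`, a `ψ`-twisted form and a linear map, then it maps `f` to a multiple of `f`. -/
theorem twistedForm_semi_invariant (h1 : φ * φ ≠ 1) (h2 : φ ≠ ψ) (h3 : φ * ψ ≠ 1)
    {b c d a' b' c' d' α β γ δ : M} {L L' : M →ₗ[K] M} {N : M × M →ₗ[K] M}
    (H : ∀ x y, twistedForm φ 1 b c d (α * x + β * y) (γ * x + δ * y) =
      N (x, y) + L (twistedForm φ 1 b c d x y) + L' (twistedForm ψ a' b' c' d' x y)) :
    (∀ z, L z = twistedForm φ 1 b c d α γ * z) ∧
    crossL φ 1 b c d α β γ δ = twistedForm φ 1 b c d α γ * b ∧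
    crossR φ 1 b c d α β γ δ = twistedForm φ 1 b c d α γ * c ∧
    twistedForm φ 1 b c d β δ = twistedForm φ 1 b c d α γ * d := by
  have hφ : φ ≠ 1 := fun h => h1 (by simp [h])
  simp only [twistedForm_subst] at H
  generalize twistedForm φ 1 b c d α γ = t at *
  generalize twistedForm φ 1 b c d β δ = s at *
  generalize crossL φ 1 b c d α β γ δ = P at *
  generalize crossR φ 1 b c d α β γ δ = Q at *
  -- Polarising in the first variable at `y = 0` cancels the additive map `N` and leaves a symmetric
  -- bilinear relation.
  have hL : ∀ z, L z = t * z := by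
    refine linear_eq_mul_of_polar h1 h2 h3 (a := a') (L' := L') fun x y => ?_
    have e1 := H (x + y) 0
    have e2 := H x 0
    have e3 := H y 0
    have e4 : ((x + y, 0) : M × M) = (x, 0) + (y, 0) := by simp
    rw [e4, map_add] at e1
    simp only [twistedForm, map_add, map_zero, mul_zero, add_zero, mul_add, add_mul, one_mul,
      mul_comm x (φ y), mul_comm x (ψ y)] at e1 e2 e3 ⊢
    linear_combination e1 - e2 - e3
  -- With `L` known, the mixed part of the relation in `x` and `y` compares the cross terms.
  have hcross : P - t * b = 0 ∧ Q - t * c = 0 := by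
    refine bilin_eq_zero_of_mem_twist hφ h2 h3 (b := b') (c := c') (L := L') fun x y => ?_
    have e1 := H x y
    have e2 := H x 0
    have e3 := H 0 y
    have e4 : ((x, y) : M × M) = (x, 0) + (0, y) := by simp
    rw [e4, map_add] at e1
    simp only [hL] at e1 e2 e3
    simp only [twistedForm, map_add, map_zero, mul_zero, zero_mul, add_zero, zero_add, mul_add,
      one_mul] at e1 e2 e3 ⊢
    linear_combination e1 - e2 - e3
  have hlast : s - t * d = 0 := by
    refine (bilin_eq_zero_of_mem_twist hφ h2 h3 (P := s - t * d) (Q := s - t * d)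
      (b := d') (c := d') (L := L') fun x y => ?_).1
    have e1 := H 0 (x + y)
    have e2 := H 0 x
    have e3 := H 0 y
    have e4 : ((0, x + y) : M × M) = (0, x) + (0, y) := by simp
    rw [e4, map_add] at e1
    simp only [hL] at e1 e2 e3
    simp only [twistedForm, map_add, map_zero, mul_zero, zero_mul, add_zero, zero_add, mul_add,
      add_mul, mul_comm x (φ y), mul_comm x (ψ y)] at e1 e2 e3 ⊢
    linear_combination e1 - e2 - e3
  exact ⟨hL, sub_eq_zero.1 hcross.1, sub_eq_zero.1 hcross.2, sub_eq_zero.1 hlast⟩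

/-- A linear relation between the values of a `φ`-twisted form with leading coefficient `1`, the
values of a `ψ`-twisted form and the argument does not involve the first form. -/
theorem linear_eq_zero_of_relation (h1 : φ * φ ≠ 1) (h2 : φ ≠ ψ) (h3 : φ * ψ ≠ 1)
    {b c d a' b' c' d' : M} {L L' : M →ₗ[K] M} {N : M × M →ₗ[K] M}
    (H : ∀ x y, N (x, y) + L (twistedForm φ 1 b c d x y) +
      L' (twistedForm ψ a' b' c' d' x y) = 0) : L = 0 := by
  ext z
  -- The relation is an instance of semi-invariance for the zero substitution, whose multiplier is
  -- 0.
  have H' : ∀ x y, twistedForm φ 1 b c d (0 * x + 0 * y) (0 * x + 0 * y) =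
      N (x, y) + L (twistedForm φ 1 b c d x y) + L' (twistedForm ψ a' b' c' d' x y) := by
    intro x y
    rw [H x y]
    simp [twistedForm]
  rw [(twistedForm_semi_invariant h1 h2 h3 H').1 z]
  simp [twistedForm]

theorem linear_eq_zero_of_single_relation {a b c d : M} (h0 : b ≠ 0 ∨ c ≠ 0)
    (h1 : b = 0 ∨ c = 0 ∨ φ * φ ≠ 1) {L : M →ₗ[K] M} {N : M × M →ₗ[K] M}
    (H : ∀ x y, N (x, y) + L (twistedForm φ a b c d x y) = 0) : L = 0 := by
  refine linear_eq_zero_of_bilin h0 h1 fun x y => ?_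
  have e1 := H x y
  have e2 := H x 0
  have e3 := H 0 y
  have e4 : ((x, y) : M × M) = (x, 0) + (0, y) := by simp
  rw [e4, map_add] at e1
  simp only [twistedForm, map_add, map_zero, mul_zero, zero_mul, add_zero, zero_add]
    at e1 e2 e3 ⊢
  linear_combination e1 - e2 - e3

/-- If a substitution maps `b φ(x) y + c x φ(y)` to a linear expression in this form, a
`ψ`-twisted form and a linear map, then it does not produce terms `φ(x) x` and `φ(y) y`. -/
theorem twistedForm_columns_eq_zero (h1 : φ ≠ 1) (h2 : φ ≠ ψ) (h3 : φ * ψ ≠ 1)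
    {b c a' b' c' d' α β γ δ : M} {L L' : M →ₗ[K] M} {N : M × M →ₗ[K] M}
    (H : ∀ x y, twistedForm φ 0 b c 0 (α * x + β * y) (γ * x + δ * y) =
      N (x, y) + L' (twistedForm ψ a' b' c' d' x y) + L (twistedForm φ 0 b c 0 x y)) :
    twistedForm φ 0 b c 0 α γ = 0 ∧ twistedForm φ 0 b c 0 β δ = 0 := by
  simp only [twistedForm_subst] at H
  generalize twistedForm φ 0 b c 0 α γ = t at *
  generalize twistedForm φ 0 b c 0 β δ = s at *
  constructor
  · refine (bilin_eq_zero_of_mem_twist h1 h2 h3 (P := t) (Q := t)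
      (b := a') (c := a') (L := L') fun x y => ?_).1
    have e1 := H (x + y) 0
    have e2 := H x 0
    have e3 := H y 0
    have e4 : ((x + y, 0) : M × M) = (x, 0) + (y, 0) := by simp
    rw [e4, map_add] at e1
    simp only [twistedForm, map_add, map_zero, mul_zero, zero_mul, add_zero, mul_add,
      add_mul, mul_comm x (φ y), mul_comm x (ψ y)] at e1 e2 e3 ⊢
    linear_combination e1 - e2 - e3
  · refine (bilin_eq_zero_of_mem_twist h1 h2 h3 (P := s) (Q := s)
      (b := d') (c := d') (L := L') fun x y => ?_).1
    have e1 := H 0 (x + y)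
    have e2 := H 0 x
    have e3 := H 0 y
    have e4 : ((0, x + y) : M × M) = (0, x) + (0, y) := by simp
    rw [e4, map_add] at e1
    simp only [twistedForm, map_add, map_zero, mul_zero, zero_mul, add_zero, zero_add, mul_add,
      add_mul, mul_comm x (φ y), mul_comm x (ψ y)] at e1 e2 e3 ⊢
    linear_combination e1 - e2 - e3

end TwistedForms

/-! ### The stabilizer of a form without roots -/

section Stabilizer

variable {K M : Type*} [Field K] [Field M] [Algebra K M]

/-- The matrix `H` for which `twistedForm φ a b c d v` is the determinant of `v` and `H φ(v)`. -/
def formMatrix (a b c d : M) : Matrix (Fin 2) (Fin 2) M := !![-b, -d; a, c]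

/-- The matrices that commute with the semilinear map `v ↦ H φ(v)`. -/
def IsTwistCentral (φ : Gal(M/K)) (H S : Matrix (Fin 2) (Fin 2) M) : Prop :=
  H * S.map φ = S * H

theorem IsTwistCentral.add {φ : Gal(M/K)} {H S T : Matrix (Fin 2) (Fin 2) M}
    (hS : IsTwistCentral φ H S) (hT : IsTwistCentral φ H T) : IsTwistCentral φ H (S + T) := by
  unfold IsTwistCentral at *
  rw [Matrix.map_add _ (map_add φ), mul_add, add_mul, hS, hT]

theorem IsTwistCentral.one {φ : Gal(M/K)} {H : Matrix (Fin 2) (Fin 2) M} :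
    IsTwistCentral φ H 1 := by
  simp [IsTwistCentral, Matrix.map_one]

variable {φ : Gal(M/K)} {a b c d : M}

/-- The form is `det(v, Hφ(v))` and `Hφ(Sv) = S Hφ(v)`, so both columns acquire the factor `S`. -/
theorem twistedForm_subst_of_isTwistCentral {S : Matrix (Fin 2) (Fin 2) M}
    (hS : IsTwistCentral φ (formMatrix a b c d) S) (x y : M) :
    twistedForm φ a b c d (S 0 0 * x + S 0 1 * y) (S 1 0 * x + S 1 1 * y) =
      S.det * twistedForm φ a b c d x y := by
  unfold IsTwistCentral formMatrix at hS
  have h00 := congr_fun₂ hS 0 0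
  have h01 := congr_fun₂ hS 0 1
  have h10 := congr_fun₂ hS 1 0
  have h11 := congr_fun₂ hS 1 1
  simp only [Matrix.mul_apply, Fin.sum_univ_two, Matrix.map_apply, Matrix.of_apply,
    Matrix.cons_val', Matrix.cons_val_zero, Matrix.cons_val_one, Matrix.cons_val_fin_one]
    at h00 h01 h10 h11
  rw [Matrix.det_fin_two]
  simp only [twistedForm, map_add, map_mul]
  linear_combination (S 0 0 * x + S 0 1 * y) * (φ x * h10 + φ y * h11) -
    (S 1 0 * x + S 1 1 * y) * (φ x * h00 + φ y * h01)

theorem det_fixed_of_isTwistCentral {S : Matrix (Fin 2) (Fin 2) M}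
    {H : Matrix (Fin 2) (Fin 2) M} (hH : H.det ≠ 0)
    (hS : IsTwistCentral φ H S) : φ S.det = S.det := by
  have h := congrArg Matrix.det hS
  rw [Matrix.det_mul, Matrix.det_mul, mul_comm] at h
  have h' := mul_right_cancel₀ hH h
  simp only [Matrix.det_fin_two, Matrix.map_apply] at h' ⊢
  simpa using h'

/-- The preimage under `φ` of a kernel vector of `H` would be a root of the form. -/
theorem det_formMatrix_ne_zero (h0 : ∀ x y, twistedForm φ a b c d x y = 0 → x = 0 ∧ y = 0) :
    (formMatrix a b c d).det ≠ 0 := by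
  intro hdet
  obtain ⟨w, hw, hHw⟩ := Matrix.exists_mulVec_eq_zero_iff.2 hdet
  have e0 := congr_fun hHw 0
  have e1 := congr_fun hHw 1
  simp only [formMatrix, Matrix.mulVec, dotProduct, Fin.sum_univ_two, Matrix.of_apply,
    Matrix.cons_val', Matrix.cons_val_zero, Matrix.cons_val_one, Matrix.cons_val_fin_one,
    Pi.zero_apply] at e0 e1
  have h := h0 (φ.symm (w 0)) (φ.symm (w 1)) (by
    simp only [twistedForm, AlgEquiv.apply_symm_apply]
    linear_combination φ.symm (w 0) * e1 - φ.symm (w 1) * e0)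
  apply hw
  ext i
  fin_cases i
  · simpa using h.1
  · simpa using h.2

/-- The determinant is fixed by `φ`, hence 0 or 1. If it is 0, the form vanishes at both columns of
`S`, so `S = 0`. -/
theorem det_eq_one_of_isTwistCentral (hfix : ∀ x, φ x = x → x = 0 ∨ x = 1)
    (h0 : ∀ x y, twistedForm φ a b c d x y = 0 → x = 0 ∧ y = 0)
    {S : Matrix (Fin 2) (Fin 2) M} (hS : IsTwistCentral φ (formMatrix a b c d) S) (hne : S ≠ 0) :
    S.det = 1 := by
  refine (hfix _ (det_fixed_of_isTwistCentral (det_formMatrix_ne_zero h0) hS)).resolve_left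
    fun hdet => hne ?_
  have h := twistedForm_subst_of_isTwistCentral hS
  simp only [hdet, zero_mul] at h
  have h1 := h0 _ _ (h 1 0)
  have h2 := h0 _ _ (h 0 1)
  simp only [mul_one, mul_zero, add_zero, zero_add] at h1 h2
  ext i j
  fin_cases i <;> fin_cases j <;> simp [h1, h2]

/-- A substitution that maps a form without roots to a multiple of it is, up to a scalar,
given by a matrix commuting with the semilinear map of the form. -/
theorem exists_smul_isTwistCentral (hdiv : ∀ x : M, x ≠ 0 → ∃ t, t ≠ 0 ∧ φ t = x * t)
    (h0 : ∀ x y, twistedForm φ a b c d x y = 0 → x = 0 ∧ y = 0)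
    {S : Matrix (Fin 2) (Fin 2) M} (hdet : S.det ≠ 0) {l : M}
    (e1 : twistedForm φ a b c d (S 0 0) (S 1 0) = l * a)
    (e2 : crossL φ a b c d (S 0 0) (S 0 1) (S 1 0) (S 1 1) = l * b)
    (e3 : crossR φ a b c d (S 0 0) (S 0 1) (S 1 0) (S 1 1) = l * c)
    (e4 : twistedForm φ a b c d (S 0 1) (S 1 1) = l * d) :
    ∃ t : M, t ≠ 0 ∧ IsTwistCentral φ (formMatrix a b c d) (t • S) := by
  have hl : l ≠ 0 := by
    rintro rfl
    rw [zero_mul] at e1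
    obtain ⟨h, h'⟩ := h0 _ _ e1
    exact hdet (by rw [Matrix.det_fin_two, h, h']; ring)
  -- Scaling `S` by `t` changes the commutation defect by `φ(t) / t`, and `key` below shows that the
  -- defect to be cancelled is `det S / l`.
  obtain ⟨t, ht, hφt⟩ := hdiv (S.det / l) (div_ne_zero hdet hl)
  have hφt' : φ t * l = S.det * t := by
    rw [hφt]
    field_simp
  refine ⟨t, ht, ?_⟩
  -- For the standard alternating matrix `J`, the four hypotheses say `Sᵀ J H φ(S) = l J H`;
  -- multiplying out with `Sᵀ J = J adj(S)` gives this.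
  have key : S.det • (formMatrix a b c d * S.map φ) = l • (S * formMatrix a b c d) := by
    unfold formMatrix
    rw [Matrix.det_fin_two]
    simp only [twistedForm, crossL, crossR] at e1 e2 e3 e4
    ext i j
    fin_cases i <;> fin_cases j <;>
    simp only [Matrix.mul_apply, Fin.sum_univ_two, Matrix.map_apply, Matrix.of_apply,
      Matrix.cons_val', Matrix.cons_val_zero, Matrix.cons_val_one, Matrix.cons_val_fin_one,
      Matrix.smul_apply, smul_eq_mul, Fin.zero_eta, Fin.mk_one, Fin.isValue]
    · linear_combination S 0 1 * e1 - S 0 0 * e2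
    · linear_combination S 0 1 * e3 - S 0 0 * e4
    · linear_combination S 1 1 * e1 - S 1 0 * e2
    · linear_combination S 1 1 * e3 - S 1 0 * e4
  have hmap : (t • S).map φ = φ t • S.map φ := by
    ext i j
    simp
  unfold IsTwistCentral
  rw [hmap, Matrix.mul_smul, Matrix.smul_mul]
  apply smul_right_injective _ (mul_ne_zero hdet hl)
  change (S.det * l) • _ = (S.det * l) • _
  rw [smul_smul, mul_comm S.det l, mul_assoc, mul_smul, mul_comm S.det, mul_smul _ S.det, key,
    smul_smul, smul_smul, smul_smul]
  congr 1
  linear_combination l * hφt'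

variable [CharP M 2]

/-- In characteristic two `det(S + 1) = det S + tr S + 1`, and both determinants are 1. -/
theorem trace_eq_one_of_isTwistCentral (hfix : ∀ x, φ x = x → x = 0 ∨ x = 1)
    (h0 : ∀ x y, twistedForm φ a b c d x y = 0 → x = 0 ∧ y = 0)
    {S : Matrix (Fin 2) (Fin 2) M} (hS : IsTwistCentral φ (formMatrix a b c d) S) (hne : S ≠ 0)
    (hne1 : S ≠ 1) : S.trace = 1 := by
  have h2 : (2 : M) = 0 := CharTwo.two_eq_zero
  have h1 := det_eq_one_of_isTwistCentral hfix h0 hS hne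
  have h3 := det_eq_one_of_isTwistCentral hfix h0 (hS.add .one) fun h => hne1 <| by
    have := eq_neg_of_add_eq_zero_left h
    rw [this]
    ext i j
    simp [CharTwo.neg_eq]
  rw [Matrix.det_fin_two] at h1 h3
  simp only [Matrix.add_apply, Matrix.one_apply_eq, ne_eq, zero_ne_one, not_false_eq_true,
    Matrix.one_apply_ne, one_ne_zero, add_zero] at h3
  rw [Matrix.trace_fin_two]
  linear_combination h3 - h1 - h2

/-- For any other `S`, the sum `S + T` would also have trace 1, whereas its trace is `1 + 1 = 0`. -/
theorem isTwistCentral_cases (hfix : ∀ x, φ x = x → x = 0 ∨ x = 1)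
    (h0 : ∀ x y, twistedForm φ a b c d x y = 0 → x = 0 ∧ y = 0)
    {S T : Matrix (Fin 2) (Fin 2) M} (hT : IsTwistCentral φ (formMatrix a b c d) T)
    (hT0 : T ≠ 0) (hT1 : T ≠ 1) (hS : IsTwistCentral φ (formMatrix a b c d) S) (hne : S ≠ 0) :
    S = 1 ∨ S = T ∨ S = T + 1 := by
  by_cases hS1 : S = 1
  · exact Or.inl hS1
  refine Or.inr ?_
  have hneg : ∀ U : Matrix (Fin 2) (Fin 2) M, -U = U := fun U => by
    ext i j
    simp [CharTwo.neg_eq]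
  have h1 := trace_eq_one_of_isTwistCentral hfix h0 hT hT0 hT1
  have h2 := trace_eq_one_of_isTwistCentral hfix h0 hS hne hS1
  by_contra! h
  have h3 := trace_eq_one_of_isTwistCentral hfix h0 (hS.add hT)
    (fun e => h.1 (by rw [eq_neg_of_add_eq_zero_left e, hneg]))
    (fun e => h.2 (by rw [eq_sub_of_add_eq e, sub_eq_add_neg, hneg, add_comm]))
  rw [Matrix.trace_add, h1, h2, CharTwo.add_self_eq_zero] at h3
  exact zero_ne_one h3

end Stabilizer

/-! ### Existence of a nontrivial stabilizing matrix -/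

section StabilizerExists

variable {K M : Type*} [Field K] [Field M] [Algebra K M]

/-- The semilinear map `v ↦ H φ(v)`. -/
def twistMap (φ : Gal(M/K)) (H : Matrix (Fin 2) (Fin 2) M) (v : Fin 2 → M) : Fin 2 → M :=
  H.mulVec (φ ∘ v)

theorem twistMap_add (φ : Gal(M/K)) (H : Matrix (Fin 2) (Fin 2) M) (v w : Fin 2 → M) :
    twistMap φ H (v + w) = twistMap φ H v + twistMap φ H w := by
  unfold twistMap
  rw [← Matrix.mulVec_add]
  congr 1
  ext i
  simp

theorem twistMap_smul (φ : Gal(M/K)) (H : Matrix (Fin 2) (Fin 2) M) (t : M) (v : Fin 2 → M) :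
    twistMap φ H (t • v) = φ t • twistMap φ H v := by
  unfold twistMap
  rw [← Matrix.mulVec_smul]
  congr 1
  ext i
  simp

theorem twistMap_iterate_add (φ : Gal(M/K)) (H : Matrix (Fin 2) (Fin 2) M) (n : ℕ)
    (v w : Fin 2 → M) :
    (twistMap φ H)^[n] (v + w) = (twistMap φ H)^[n] v + (twistMap φ H)^[n] w := by
  induction n with
  | zero => rfl
  | succ n ih => rw [Function.iterate_succ_apply', Function.iterate_succ_apply',
      Function.iterate_succ_apply', ih, twistMap_add]

theorem twistMap_iterate_smul (φ : Gal(M/K)) (H : Matrix (Fin 2) (Fin 2) M) (n : ℕ)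
    (t : M) (v : Fin 2 → M) :
    (twistMap φ H)^[n] (t • v) = (φ ^ n) t • (twistMap φ H)^[n] v := by
  induction n with
  | zero => rfl
  | succ n ih => rw [Function.iterate_succ_apply', Function.iterate_succ_apply', ih,
      twistMap_smul, pow_succ', AlgEquiv.mul_apply]

theorem twistedForm_eq_zero_of_twistMap_eq {φ : Gal(M/K)} {a b c d : M} {v : Fin 2 → M}
    (hv : twistMap φ (formMatrix a b c d) v = v) : twistedForm φ a b c d (v 0) (v 1) = 0 := by
  have e0 := congr_fun hv 0
  have e1 := congr_fun hv 1
  simp only [twistMap, formMatrix, Matrix.mulVec, dotProduct, Fin.sum_univ_two, Matrix.of_apply,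
    Matrix.cons_val', Matrix.cons_val_zero, Matrix.cons_val_one, Matrix.cons_val_fin_one,
    Function.comp_apply] at e0 e1
  simp only [twistedForm]
  linear_combination v 0 * e1 - v 1 * e0

/-- If a power of a semilinear map is the identity, then the map has fixed vectors. -/
theorem exists_twistMap_eq {φ : Gal(M/K)} (hφ : 0 < orderOf φ) {H : Matrix (Fin 2) (Fin 2) M}
    (hid : ∀ v, (twistMap φ H)^[orderOf φ] v = v) : ∃ v, v ≠ 0 ∧ twistMap φ H v = v := by
  set n := orderOf φ with hn
  let e : Fin 2 → M := Pi.single 0 1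
  -- The trace of `t • e` over the cyclic action of the semilinear map, hence a fixed vector.
  let w : M → Fin 2 → M := fun t => ∑ i ∈ Finset.range n, (twistMap φ H)^[i] (t • e)
  have hw : ∀ t, twistMap φ H (w t) = w t := by
    intro t
    have h1 : twistMap φ H (w t) = ∑ i ∈ Finset.range n, (twistMap φ H)^[i + 1] (t • e) := by
      simp only [w, Function.iterate_succ_apply']
      exact map_sum (AddMonoidHom.mk' (twistMap φ H) (twistMap_add φ H)) _ _
    have h2 := Finset.sum_range_succ (fun i => (twistMap φ H)^[i] (t • e)) n
    rw [Finset.sum_range_succ', hid] at h2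
    rw [h1]
    exact add_right_cancel h2
  by_contra! hno
  have hz : ∀ t, w t = 0 := fun t => by_contra fun h => hno _ h (hw t)
  have hinj : Function.Injective fun i : Fin n => (((φ ^ (i : ℕ) : Gal(M/K)) : M →* M)) := by
    intro i j hij
    have : φ ^ (i : ℕ) = φ ^ (j : ℕ) := AlgEquiv.ext fun x => DFunLike.congr_fun hij x
    exact Fin.ext (pow_injOn_Iio_orderOf (hn ▸ i.2 : (i : ℕ) < orderOf φ)
      (hn ▸ j.2 : (j : ℕ) < orderOf φ) this)
  -- If all these traces vanish, independence of the powers of `φ` kills the coefficient of `φ⁰`,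
  -- which is the first entry of `e`, namely 1.
  have hli := (linearIndependent_monoidHom M M).comp _ hinj
  have h0 := Fintype.linearIndependent_iff.1 hli
    (fun i => (twistMap φ H)^[(i : ℕ)] e 0) (funext fun t => by
      have := congr_fun (hz t) 0
      simp only [w, Finset.sum_apply, twistMap_iterate_smul] at this
      rw [Finset.sum_range] at this
      simpa [mul_comm] using this) ⟨0, hφ⟩
  simp [e] at h0

/-- A form without roots is stabilized by a nontrivial matrix. -/
theorem exists_isTwistCentral {φ : Gal(M/K)} (hφ : 0 < orderOf φ) {a b c d : M}
    (h0 : ∀ x y, twistedForm φ a b c d x y = 0 → x = 0 ∧ y = 0) :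
    ∃ T, IsTwistCentral φ (formMatrix a b c d) T ∧ T ≠ 0 ∧ T ≠ 1 := by
  set H := formMatrix a b c d
  -- Iterating as often as the order of `φ` turns the semilinear map into an `M`-linear one, which
  -- commutes with it.
  let f : (Fin 2 → M) →ₗ[M] (Fin 2 → M) :=
    { toFun := (twistMap φ H)^[orderOf φ]
      map_add' := twistMap_iterate_add φ H _
      map_smul' := fun t v => by
        rw [twistMap_iterate_smul, pow_orderOf_eq_one]
        rfl }
  have hf : ∀ v, (LinearMap.toMatrix' f).mulVec v = (twistMap φ H)^[orderOf φ] v := by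
    intro v
    rw [← Matrix.toLin'_apply, Matrix.toLin'_toMatrix']
    rfl
  have hno : ∀ v, twistMap φ H v = v → v = 0 := by
    intro v hv
    obtain ⟨h1, h2⟩ := h0 _ _ (twistedForm_eq_zero_of_twistMap_eq hv)
    ext i
    fin_cases i <;> assumption
  refine ⟨LinearMap.toMatrix' f, ?_, ?_, ?_⟩
  · unfold IsTwistCentral
    refine Matrix.ext_of_mulVec_single fun i => ?_
    have h1 : φ ∘ (Pi.single i 1 : Fin 2 → M) = Pi.single i 1 := by
      ext j
      by_cases h : j = i <;> simp [h]
    have h2 : (LinearMap.toMatrix' f).mulVec (twistMap φ H (Pi.single i 1)) =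
        twistMap φ H ((LinearMap.toMatrix' f).mulVec (Pi.single i 1)) := by
      rw [hf, hf]
      exact (Function.iterate_succ_apply _ _ _).symm.trans (Function.iterate_succ_apply' _ _ _)
    rw [← Matrix.mulVec_mulVec, ← Matrix.mulVec_mulVec]
    rw [twistMap, h1] at h2
    rw [h2, twistMap]
    congr 1
    ext j
    simp
  · intro hT
    have hinj : ∀ v, twistMap φ H v = 0 → v = 0 := by
      intro v hv
      have hdet := det_formMatrix_ne_zero h0
      have : φ ∘ v = 0 := Matrix.eq_zero_of_mulVec_eq_zero hdet hv
      ext i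
      simpa using congr_fun this i
    have hn : ∀ n v, (twistMap φ H)^[n] v = 0 → v = 0 := by
      intro n
      induction n with
      | zero => exact fun v h => h
      | succ n ih => exact fun v h => hinj v (ih _ h)
    have := hn _ (Pi.single 0 1) (by rw [← hf, hT, Matrix.zero_mulVec])
    simpa using congr_fun this 0
  -- If the iterate were the identity, the semilinear map would have a nonzero fixed vector, and
  -- that is a root of the form.
  · intro hT
    obtain ⟨v, hv, hv'⟩ := exists_twistMap_eq hφ (H := H) fun v => by
      rw [← hf, hT, Matrix.one_mulVec]
    exact hv (hno v hv')

end StabilizerExists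

/-! ### Powers of the Frobenius automorphism -/

section Frobenius

variable {M : Type*} [Field M] [Finite M] [Algebra (ZMod 2) M]

variable (M) in
/-- The automorphism `x ↦ x ^ 2 ^ k`. -/
noncomputable def frob (k : ℕ) : Gal(M/ZMod 2) :=
  FiniteField.frobeniusAlgEquivOfAlgebraic (ZMod 2) M ^ k

theorem frob_apply (k : ℕ) (x : M) : frob M k x = x ^ 2 ^ k := by
  rw [frob, AlgEquiv.coe_pow, FiniteField.coe_frobeniusAlgEquivOfAlgebraic_iterate, ZMod.card]

theorem frob_mul (k l : ℕ) : frob M k * frob M l = frob M (k + l) := (pow_add _ _ _).symm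

theorem biproj_eq_twistedForm (k : ℕ) (a b c d x y : M) :
    biproj k a b c d x y = twistedForm (frob M k) a b c d x y := by
  simp only [biproj, twistedForm, frob_apply, pow_succ]

theorem finrank_of_card {m : ℕ} (hcard : Nat.card M = 2 ^ m) :
    Module.finrank (ZMod 2) M = m := by
  have := Module.natCard_eq_pow_finrank (K := ZMod 2) (V := M)
  rw [hcard, Nat.card_zmod] at this
  exact (Nat.pow_right_injective le_rfl this).symm

theorem orderOf_frob_one {m : ℕ} (hcard : Nat.card M = 2 ^ m) :
    orderOf (FiniteField.frobeniusAlgEquivOfAlgebraic (ZMod 2) M) = m := by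
  rw [FiniteField.orderOf_frobeniusAlgEquivOfAlgebraic, finrank_of_card hcard]

theorem frob_eq_one_iff {m : ℕ} (hcard : Nat.card M = 2 ^ m) (k : ℕ) :
    frob M k = 1 ↔ m ∣ k := by
  rw [frob, ← orderOf_dvd_iff_pow_eq_one, orderOf_frob_one hcard]

theorem frob_eq_frob_iff {m : ℕ} (hcard : Nat.card M = 2 ^ m) (k l : ℕ) :
    frob M k = frob M l ↔ k ≡ l [MOD m] := by
  rw [frob, frob, pow_eq_pow_iff_modEq, orderOf_frob_one hcard]

/-- As `k` is invertible modulo `m`, some power of this automorphism is `x ↦ x²`. -/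
theorem frob_fixed {m : ℕ} (hm : 1 < m) (hcard : Nat.card M = 2 ^ m) {k : ℕ}
    (hk : Nat.gcd k m = 1) (x : M) (hx : frob M k x = x) : x = 0 ∨ x = 1 := by
  have h1 : ∀ n, (frob M k ^ n) x = x := by
    intro n
    induction n with
    | zero => rfl
    | succ n ih => rw [pow_succ, AlgEquiv.mul_apply, hx, ih]
  obtain ⟨n, hn⟩ : ∃ n, k * n ≡ 1 [MOD m] :=
    (Nat.exists_mul_mod_eq_one_of_coprime hk hm).imp fun n hn =>
      hn.2.trans (Nat.mod_eq_of_lt hm).symm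
  have h2 : frob M k ^ n = frob M 1 := by
    rw [frob, ← pow_mul]
    exact (frob_eq_frob_iff hcard _ _).2 hn
  have h3 := h1 n
  rw [h2, frob_apply] at h3
  have h4 : x * (x - 1) = 0 := by linear_combination h3
  rcases mul_eq_zero.1 h4 with h | h
  · exact Or.inl h
  · exact Or.inr (sub_eq_zero.1 h)

/-- The endomorphism `u ↦ φ(u) / u` of the finite group `Mˣ` has trivial kernel, so it is
surjective. -/
theorem exists_frob_eq_mul {k : ℕ} (hfix : ∀ x, frob M k x = x → x = 0 ∨ x = 1) (x : M)
    (hx : x ≠ 0) : ∃ t, t ≠ 0 ∧ frob M k t = x * t := by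
  let f : Mˣ →* Mˣ := Units.map (frob M k : M →* M) / MonoidHom.id Mˣ
  have hf : ∀ u : Mˣ, ((f u : Mˣ) : M) = frob M k u / u := by
    intro u
    simp [f, div_eq_mul_inv]
  have hinj : Function.Injective f := by
    rw [injective_iff_map_eq_one]
    intro u hu
    have h := hf u
    rw [hu, Units.val_one, eq_div_iff u.ne_zero, one_mul] at h
    exact Units.ext ((hfix _ h.symm).resolve_left u.ne_zero)
  obtain ⟨t, ht⟩ := Finite.surjective_of_injective hinj (Units.mk0 x hx)
  refine ⟨t, t.ne_zero, ?_⟩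
  have h := hf t
  rw [ht, Units.val_mk0, eq_div_iff t.ne_zero] at h
  exact h.symm

end Frobenius

/-! ### Automorphisms with an `M`-linear block -/

section ScalarBlocks

variable {M : Type*} [Field M] [Algebra (ZMod 2) M]

/-- The action of a matrix over `M` on `M × M`, as an `F_2`-linear map. -/
def matAct (S : Matrix (Fin 2) (Fin 2) M) : M × M →ₗ[ZMod 2] M × M where
  toFun u := (S 0 0 * u.1 + S 0 1 * u.2, S 1 0 * u.1 + S 1 1 * u.2)
  map_add' u v := by
    ext <;> simp <;> ring
  map_smul' t u := by
    ext <;> simp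

theorem matAct_apply (S : Matrix (Fin 2) (Fin 2) M) (x y : M) :
    matAct S (x, y) = (S 0 0 * x + S 0 1 * y, S 1 0 * x + S 1 1 * y) := rfl

theorem matAct_mul (S T : Matrix (Fin 2) (Fin 2) M) (u : M × M) :
    matAct (S * T) u = matAct S (matAct T u) := by
  obtain ⟨x, y⟩ := u
  simp only [matAct_apply, Matrix.mul_apply, Fin.sum_univ_two]
  ext <;> simp <;> ring

theorem matAct_injective {S : Matrix (Fin 2) (Fin 2) M} (hS : S.det ≠ 0) :
    Function.Injective (matAct S) := by
  refine (injective_iff_map_eq_zero _).2 fun u hu => ?_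
  obtain ⟨x, y⟩ := u
  rw [matAct_apply, Prod.mk_eq_zero] at hu
  rw [Matrix.det_fin_two] at hS
  rw [Prod.mk_eq_zero]
  constructor
  · refine (mul_eq_zero.1 (?_ : (S 0 0 * S 1 1 - S 0 1 * S 1 0) * x = 0)).resolve_left hS
    linear_combination S 1 1 * hu.1 - S 0 1 * hu.2
  · refine (mul_eq_zero.1 (?_ : (S 0 0 * S 1 1 - S 0 1 * S 1 0) * y = 0)).resolve_left hS
    linear_combination S 0 0 * hu.2 - S 1 0 * hu.1

theorem det_ne_zero_of_matAct_injective {S : Matrix (Fin 2) (Fin 2) M}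
    (hS : Function.Injective (matAct S)) : S.det ≠ 0 := by
  intro hdet
  have h0 : ∀ x y, S 0 0 * x + S 0 1 * y = 0 → S 1 0 * x + S 1 1 * y = 0 → x = 0 ∧ y = 0 := by
    intro x y h1 h2
    have : matAct S (x, y) = matAct S 0 := by
      rw [map_zero, matAct_apply, h1, h2]
      rfl
    simpa using hS this
  rw [Matrix.det_fin_two] at hdet
  obtain ⟨h1, h2⟩ := h0 (S 1 1) (-S 1 0) (by linear_combination hdet) (by ring)
  obtain ⟨h3, h4⟩ := h0 (S 0 1) (-S 0 0) (by ring) (by linear_combination -hdet)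
  have := (h0 1 0 (by simp [neg_eq_zero.1 h4]) (by simp [neg_eq_zero.1 h2])).1
  exact one_ne_zero this

/-- The upper left block of `T` is the matrix `S` over `M`, and the upper right block is zero. -/
def HasBlock (T : GLFF M) (S : Matrix (Fin 2) (Fin 2) M) : Prop :=
  ∀ u v, (T (u, v)).1 = matAct S u

theorem HasBlock.mul {T T' : GLFF M} {S S' : Matrix (Fin 2) (Fin 2) M} (h : HasBlock T S)
    (h' : HasBlock T' S') : HasBlock (T * T') (S * S') := by
  intro u v
  rw [LinearEquiv.mul_apply, matAct_mul, ← h' u v]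
  exact h _ _

theorem HasBlock.unique {T : GLFF M} {S S' : Matrix (Fin 2) (Fin 2) M} (h : HasBlock T S)
    (h' : HasBlock T S') : S = S' := by
  have e1 := (h (1, 0) 0).symm.trans (h' (1, 0) 0)
  have e2 := (h (0, 1) 0).symm.trans (h' (0, 1) 0)
  simp only [matAct_apply, mul_one, mul_zero, add_zero, zero_add, Prod.mk.injEq] at e1 e2
  ext i j
  fin_cases i <;> fin_cases j
  exacts [e1.1, e2.1, e1.2, e2.2]

theorem zHom_apply (k l : ℕ) (a : Mˣ) (x y z w : M) :
    zHom k l a ((x, y), (z, w)) =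
      ((a * x, a * y), ((a : M) ^ (2 ^ k + 1) * z, (a : M) ^ (2 ^ l + 1) * w)) := rfl

theorem hasBlock_zHom (k l : ℕ) (a : Mˣ) :
    HasBlock (zHom k l a) ((a : M) • (1 : Matrix (Fin 2) (Fin 2) M)) := by
  rintro ⟨x, y⟩ ⟨z, w⟩
  simp [zHom_apply, matAct_apply]

theorem hasBlock_diag (a b c d : Mˣ) :
    HasBlock (diag a b c d) (!![(a : M), 0; 0, (b : M)] : Matrix (Fin 2) (Fin 2) M) := by
  rintro ⟨x, y⟩ ⟨z, w⟩
  simp [diag_apply, matAct_apply]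

theorem isELMap_of_fst {T : GLFF M} {S : Matrix (Fin 2) (Fin 2) M} (h : HasBlock T S) :
    IsELMap T := by
  refine ⟨matAct S, LinearMap.snd _ _ _ ∘ₗ T.toLinearMap ∘ₗ LinearMap.inl _ _ _,
    LinearMap.snd _ _ _ ∘ₗ T.toLinearMap ∘ₗ LinearMap.inr _ _ _, fun u v => ?_⟩
  have e : ((u, v) : (M × M) × (M × M)) = (u, 0) + (0, v) := by simp
  ext1
  · exact h u v
  · rw [e, map_add]
    simp

omit [Algebra (ZMod 2) M] in
theorem biproj_smul (k : ℕ) (a b c d t x y : M) :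
    biproj k a b c d (t * x) (t * y) = t ^ (2 ^ k + 1) * biproj k a b c d x y := by
  simp only [biproj, mul_pow, pow_succ]
  ring

variable [Finite M]

/-- Mapping the graph into itself suffices, since the graph is finite and `T` is injective. -/
theorem mem_AutEL {F : M × M → M × M} {T : GLFF M} {S : Matrix (Fin 2) (Fin 2) M}
    (h : HasBlock T S) (hF : ∀ u, (T (u, F u)).2 = F (matAct S u)) : T ∈ AutEL F := by
  refine ⟨isELMap_of_fst h, ?_⟩
  refine Set.eq_of_subset_of_ncard_le ?_ (Set.ncard_image_of_injective _ T.injective).ge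
  rintro _ ⟨_, ⟨u, rfl⟩, rfl⟩
  exact ⟨matAct S u, (Prod.ext (h u (F u)) (hF u)).symm⟩

theorem Z_le_CF {k l : ℕ} {F : M × M → M × M} (hF : IsBiprojectivePair k l F)
    (P : Subgroup Mˣ) : Z M k l ≤ CF P k l F := by
  rintro _ ⟨a, rfl⟩
  refine ⟨?_, mem_AutEL (hasBlock_zHom k l a) ?_⟩
  · refine Subgroup.mem_centralizer_iff.2 ?_
    rintro _ ⟨b, -, rfl⟩
    rw [← map_mul, ← map_mul, mul_comm]
  · obtain ⟨a₀, b₀, c₀, d₀, a₁, b₁, c₁, d₁, rfl⟩ := hF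
    rintro ⟨x, y⟩
    simp [zHom_apply, matAct_apply, biproj_smul]

/-- No nontrivial linear relation holds on the graph of `F`. -/
def SpanningGraph (F : M × M → M × M) : Prop :=
  ∀ N L : M × M →ₗ[ZMod 2] M × M, (∀ v, N v + L (F v) = 0) → N = 0 ∧ L = 0

omit [Finite M] in
theorem spanningGraph_of_rows {F : M × M → M × M}
    (h : ∀ (N : M × M →ₗ[ZMod 2] M) (L L' : M →ₗ[ZMod 2] M),
      (∀ x y, N (x, y) + L (F (x, y)).1 + L' (F (x, y)).2 = 0) → L = 0 ∧ L' = 0) :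
    SpanningGraph F := by
  intro N L H
  have hL : ∀ v, L v = L (v.1, 0) + L (0, v.2) := fun v => by
    rw [← map_add]
    simp
  have h1 := h (LinearMap.fst _ _ _ ∘ₗ N) (LinearMap.fst _ _ _ ∘ₗ L ∘ₗ LinearMap.inl _ _ _)
    (LinearMap.fst _ _ _ ∘ₗ L ∘ₗ LinearMap.inr _ _ _) fun x y => by
      have := congrArg Prod.fst (H (x, y))
      rw [hL] at this
      simpa [add_assoc] using this
  have h2 := h (LinearMap.snd _ _ _ ∘ₗ N) (LinearMap.snd _ _ _ ∘ₗ L ∘ₗ LinearMap.inl _ _ _)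
    (LinearMap.snd _ _ _ ∘ₗ L ∘ₗ LinearMap.inr _ _ _) fun x y => by
      have := congrArg Prod.snd (H (x, y))
      rw [hL] at this
      simpa [add_assoc] using this
  have hL0 : L = 0 := by
    ext z
    exacts [DFunLike.congr_fun h1.1 z, DFunLike.congr_fun h2.1 z, DFunLike.congr_fun h1.2 z,
      DFunLike.congr_fun h2.2 z]
  refine ⟨LinearMap.ext fun v => ?_, hL0⟩
  have := H v
  rwa [hL0, LinearMap.zero_apply, add_zero] at this

theorem exists_of_mem_AutEL {F : M × M → M × M} {T : GLFF M} (hT : T ∈ AutEL F) :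
    ∃ S N L : M × M →ₗ[ZMod 2] M × M, (∀ u v, T (u, v) = (S u, N u + L v)) ∧
      ∀ u, F (S u) = N u + L (F u) := by
  obtain ⟨⟨S, N, L, h⟩, hg⟩ := hT
  refine ⟨S, N, L, h, fun u => ?_⟩
  have : T (u, F u) ∈ graph F := hg ▸ Set.mem_image_of_mem _ ⟨u, rfl⟩
  obtain ⟨w, hw⟩ := this
  rw [h, Prod.mk.injEq] at hw
  rw [← hw.1, hw.2]

/-- Subtracting the two identities for `F ∘ S` gives a linear relation on the graph, so the
remaining blocks agree. -/
theorem eq_of_hasBlock {F : M × M → M × M} (hF : SpanningGraph F) {T T' : GLFF M}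
    (hT : T ∈ AutEL F) (hT' : T' ∈ AutEL F) {S : Matrix (Fin 2) (Fin 2) M} (h : HasBlock T S)
    (h' : HasBlock T' S) : T = T' := by
  obtain ⟨R, N, L, e1, e2⟩ := exists_of_mem_AutEL hT
  obtain ⟨R', N', L', e1', e2'⟩ := exists_of_mem_AutEL hT'
  have hR : R = matAct S := LinearMap.ext fun u => by rw [← h u 0, e1]
  have hR' : R' = matAct S := LinearMap.ext fun u => by rw [← h' u 0, e1']
  obtain ⟨hN, hL⟩ := hF (N - N') (L - L') fun v => by
    have := (e2 v).symm.trans ((hR.trans hR'.symm ▸ rfl : F (R v) = F (R' v)).trans (e2' v))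
    simp only [LinearMap.sub_apply]
    rw [sub_add_sub_comm, this, sub_self]
  ext1 ⟨u, v⟩
  rw [e1, e1', hR, hR', sub_eq_zero.1 hN, sub_eq_zero.1 hL]

/-- A subalgebra containing an element whose order is a primitive divisor is everything. -/
theorem subalgebra_eq_top {m p : ℕ} (hcard : Nat.card M = 2 ^ m)
    (hp : IsPrimitiveDivisor m p) {ζ : Mˣ} (hζ : orderOf ζ = p) (A : Subalgebra (ZMod 2) M)
    (hA : (ζ : M) ∈ A) : A = ⊤ := by
  classical
  have := Fintype.ofFinite A
  let _ : Field A := Fintype.fieldOfDomain A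
  have hfin := Module.natCard_eq_pow_finrank (K := ZMod 2) (V := A)
  rw [Nat.card_zmod] at hfin
  have hle : Module.finrank (ZMod 2) A ≤ m :=
    (Submodule.finrank_le (Subalgebra.toSubmodule A)).trans (finrank_of_card hcard).le
  have hζA : (⟨ζ, hA⟩ : A) ≠ 0 := fun h => ζ.ne_zero (congrArg Subtype.val h)
  have hpow := FiniteField.pow_card_sub_one_eq_one (⟨ζ, hA⟩ : A) hζA
  have hdvd : p ∣ 2 ^ Module.finrank (ZMod 2) A - 1 := by
    rw [← hζ, orderOf_dvd_iff_pow_eq_one, ← hfin, Nat.card_eq_fintype_card]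
    exact Units.ext (by simpa using congrArg Subtype.val hpow)
  have hpos : 0 < Module.finrank (ZMod 2) A := Module.finrank_pos
  have heq : Module.finrank (ZMod 2) A = m :=
    hle.antisymm (not_lt.1 fun h => hp.2.2 _ hpos h hdvd)
  apply Subalgebra.toSubmodule_injective
  exact Submodule.eq_top_of_finrank_eq (heq.trans (finrank_of_card hcard).symm)

/-- The scalars commuting with `f` form a subalgebra containing `ζ`, which is all of `M`. -/
theorem linear_eq_mul_of_commute {m p : ℕ} (hcard : Nat.card M = 2 ^ m)
    (hp : IsPrimitiveDivisor m p) {ζ : Mˣ} (hζ : orderOf ζ = p) (f : M →ₗ[ZMod 2] M)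
    (hf : ∀ x, f (ζ * x) = ζ * f x) (x : M) : f x = f 1 * x := by
  let A : Subalgebra (ZMod 2) M :=
    { carrier := {t | ∀ x, f (t * x) = t * f x}
      mul_mem' := fun {s t} hs ht x => by rw [mul_assoc, hs, ht, mul_assoc]
      add_mem' := fun {s t} hs ht x => by rw [add_mul, map_add, hs, ht, add_mul]
      algebraMap_mem' := fun r x => by
        rw [← Algebra.smul_def, map_smul, ← Algebra.smul_def] }
  have h : x ∈ A := subalgebra_eq_top hcard hp hζ A hf ▸ Algebra.mem_top
  have := h 1
  rwa [mul_one, mul_comm] at this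

/-- The centralizer of `Z_P` consists of maps whose upper left block is a matrix over `M`. -/
theorem exists_of_mem_CF {m p : ℕ} (hcard : Nat.card M = 2 ^ m) (hp : IsPrimitiveDivisor m p)
    (P : Sylow p Mˣ) {k l : ℕ} {F : M × M → M × M} {T : GLFF M}
    (hT : T ∈ CF (P : Subgroup Mˣ) k l F) :
    ∃ (S : Matrix (Fin 2) (Fin 2) M) (N L : M × M →ₗ[ZMod 2] M × M),
      HasBlock T S ∧ S.det ≠ 0 ∧ ∀ u, F (matAct S u) = N u + L (F u) := by
  have : Fact p.Prime := ⟨hp.1⟩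
  obtain ⟨ζ, hζP, hζ⟩ : ∃ ζ ∈ (P : Subgroup Mˣ), orderOf ζ = p := by
    have hdvd : p ∣ Nat.card Mˣ := by
      rw [Nat.card_units, hcard]
      exact hp.2.1
    obtain ⟨x, hx⟩ := exists_prime_orderOf_dvd_card' (G := (P : Subgroup Mˣ)) p
      (P.dvd_card_of_dvd_card hdvd)
    exact ⟨x, x.2, by rwa [Subgroup.orderOf_coe]⟩
  obtain ⟨hc, hA⟩ := hT
  obtain ⟨R, N, L, e1, e2⟩ := exists_of_mem_AutEL hA
  have hcomm : ∀ x y, R (ζ * x, ζ * y) = ((ζ : M) * (R (x, y)).1, (ζ : M) * (R (x, y)).2) := by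
    intro x y
    have h := Subgroup.mem_centralizer_iff.1 hc (zHom k l ζ) ⟨ζ, hζP, rfl⟩
    have h := congrArg Prod.fst (DFunLike.congr_fun h ((x, y), (0, 0)))
    rw [LinearEquiv.mul_apply, LinearEquiv.mul_apply, zHom_apply, e1, e1] at h
    exact h.symm
  have key : ∀ f : M →ₗ[ZMod 2] M, (∀ x, f (ζ * x) = ζ * f x) → ∀ x, f x = f 1 * x :=
    linear_eq_mul_of_commute hcard hp hζ
  have k00 := key (LinearMap.fst _ _ _ ∘ₗ R ∘ₗ LinearMap.inl _ _ _) fun x => by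
    simpa using congrArg Prod.fst (hcomm x 0)
  have k01 := key (LinearMap.fst _ _ _ ∘ₗ R ∘ₗ LinearMap.inr _ _ _) fun x => by
    simpa using congrArg Prod.fst (hcomm 0 x)
  have k10 := key (LinearMap.snd _ _ _ ∘ₗ R ∘ₗ LinearMap.inl _ _ _) fun x => by
    simpa using congrArg Prod.snd (hcomm x 0)
  have k11 := key (LinearMap.snd _ _ _ ∘ₗ R ∘ₗ LinearMap.inr _ _ _) fun x => by
    simpa using congrArg Prod.snd (hcomm 0 x)
  simp only [LinearMap.comp_apply, LinearMap.fst_apply, LinearMap.snd_apply, LinearMap.inl_apply,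
    LinearMap.inr_apply] at k00 k01 k10 k11
  let S : Matrix (Fin 2) (Fin 2) M :=
    !![(R (1, 0)).1, (R (0, 1)).1; (R (1, 0)).2, (R (0, 1)).2]
  have hR : ∀ u, R u = matAct S u := by
    rintro ⟨x, y⟩
    have e : ((x, y) : M × M) = (x, 0) + (0, y) := by simp
    rw [e, map_add, ← e, matAct_apply]
    ext1
    · simp [S, ← k00, ← k01]
    · simp [S, ← k10, ← k11]
  have hblock : HasBlock T S := fun u v => by rw [e1, hR]
  refine ⟨S, N, L, hblock, det_ne_zero_of_matAct_injective ?_, fun u => by rw [← hR, e2]⟩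
  refine Finite.injective_iff_surjective.2 fun u => ?_
  obtain ⟨⟨w, z⟩, hw⟩ := T.surjective (u, 0)
  exact ⟨w, by rw [← hblock w z, hw]⟩

end ScalarBlocks

/-! ### Cosets of `Z` in `C_F` and lifting of blocks -/

section Index

theorem relIndex_eq_three_of_cosets {G : Type*} [Group G] {H K : Subgroup G} {x y : G}
    (hx : x ∈ K) (hy : y ∈ K) (hxH : x ∉ H) (hyH : y ∉ H) (hxy : x⁻¹ * y ∉ H)
    (h : ∀ z ∈ K, z ∈ H ∨ x⁻¹ * z ∈ H ∨ y⁻¹ * z ∈ H) : H.relIndex K = 3 := by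
  let π : K → K ⧸ H.subgroupOf K := QuotientGroup.mk
  have hπ : ∀ a b : K, π a = π b ↔ (a : G)⁻¹ * b ∈ H := fun a b => by
    rw [QuotientGroup.eq, Subgroup.mem_subgroupOf]
    rfl
  have huniv : (Set.univ : Set (K ⧸ H.subgroupOf K)) = {π 1, π ⟨x, hx⟩, π ⟨y, hy⟩} := by
    refine (Set.eq_univ_of_forall fun q => ?_).symm
    obtain ⟨z, rfl⟩ := QuotientGroup.mk_surjective q
    rcases h z z.2 with hz | hz | hz
    · exact Or.inl ((hπ 1 z).2 (by simpa using hz)).symm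
    · exact Or.inr (Or.inl ((hπ ⟨x, hx⟩ z).2 hz).symm)
    · exact Or.inr (Or.inr ((hπ ⟨y, hy⟩ z).2 hz).symm)
  rw [Subgroup.relIndex, Subgroup.index, ← Set.ncard_univ, Set.ncard_eq_three]
  refine ⟨π 1, π ⟨x, hx⟩, π ⟨y, hy⟩, fun e => hxH ?_, fun e => hyH ?_, fun e => hxy ?_, huniv⟩
  · simpa using (hπ _ _).1 e
  · simpa using (hπ _ _).1 e
  · exact (hπ _ _).1 e

variable {M : Type*} [Field M] [Finite M] [Algebra (ZMod 2) M]

theorem eq_mul_zHom_of_hasBlock {k l : ℕ} {F : M × M → M × M} {P : Subgroup Mˣ}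
    (hF : SpanningGraph F) (hZ : Z M k l ≤ CF P k l F) {T T' : GLFF M} (hT : T ∈ CF P k l F)
    (hT' : T' ∈ CF P k l F) {S : Matrix (Fin 2) (Fin 2) M} {a : Mˣ} (h : HasBlock T' S)
    (hb : HasBlock T ((a : M) • S)) : T = T' * zHom k l a := by
  refine eq_of_hasBlock hF hT.2 (mul_mem hT' (hZ ⟨a, rfl⟩)).2 hb ?_
  have := h.mul (hasBlock_zHom k l a)
  rwa [Matrix.mul_smul, mul_one] at this

theorem eq_zHom_of_hasBlock {k l : ℕ} {F : M × M → M × M} {P : Subgroup Mˣ}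
    (hF : SpanningGraph F) (hZ : Z M k l ≤ CF P k l F) {T : GLFF M} (hT : T ∈ CF P k l F)
    {a : Mˣ} (hb : HasBlock T ((a : M) • (1 : Matrix (Fin 2) (Fin 2) M))) : T = zHom k l a :=
  eq_of_hasBlock hF hT.2 (hZ ⟨a, rfl⟩).2 hb (hasBlock_zHom k l a)

/-- If the blocks of the elements of `C_F` are the multiples of three pairwise nonproportional
matrices `1`, `K₁`, `K₂`, then `C_F` is the union of three cosets of `Z`. -/
theorem cosets_of_blocks {k l : ℕ} {F : M × M → M × M} {P : Subgroup Mˣ}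
    (hF : SpanningGraph F) (hZ : Z M k l ≤ CF P k l F) {K₁ K₂ : Matrix (Fin 2) (Fin 2) M}
    {T₁ T₂ : GLFF M} (h₁ : T₁ ∈ CF P k l F) (h₂ : T₂ ∈ CF P k l F) (b₁ : HasBlock T₁ K₁)
    (b₂ : HasBlock T₂ K₂) (n₁ : ∀ a : M, K₁ ≠ a • (1 : Matrix (Fin 2) (Fin 2) M))
    (n₂ : ∀ a : M, K₂ ≠ a • (1 : Matrix (Fin 2) (Fin 2) M)) (n₃ : ∀ a : M, K₂ ≠ a • K₁)
    (h : ∀ T ∈ CF P k l F, ∃ S, HasBlock T S ∧ ∃ a : M, a ≠ 0 ∧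
      (S = a • (1 : Matrix (Fin 2) (Fin 2) M) ∨ S = a • K₁ ∨ S = a • K₂)) :
    (∀ T ∈ CF P k l F, ∃ a : Mˣ, T = zHom k l a ∨ T = T₁ * zHom k l a ∨ T = T₂ * zHom k l a) ∧
      (Z M k l).relIndex (CF P k l F) = 3 := by
  have hc : ∀ T ∈ CF P k l F,
      ∃ a : Mˣ, T = zHom k l a ∨ T = T₁ * zHom k l a ∨ T = T₂ * zHom k l a := by
    intro T hT
    obtain ⟨S, hS, a, ha, hcase⟩ := h T hT
    refine ⟨Units.mk0 a ha, ?_⟩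
    rcases hcase with rfl | rfl | rfl
    · exact Or.inl (eq_zHom_of_hasBlock hF hZ hT hS)
    · exact Or.inr (Or.inl (eq_mul_zHom_of_hasBlock hF hZ hT h₁ b₁ hS))
    · exact Or.inr (Or.inr (eq_mul_zHom_of_hasBlock hF hZ hT h₂ b₂ hS))
  refine ⟨hc, relIndex_eq_three_of_cosets h₁ h₂ ?_ ?_ ?_ fun T hT => ?_⟩
  · rintro ⟨a, rfl⟩
    exact n₁ a (b₁.unique (hasBlock_zHom k l a))
  · rintro ⟨a, rfl⟩
    exact n₂ a (b₂.unique (hasBlock_zHom k l a))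
  · rintro ⟨a, ha⟩
    rw [eq_inv_mul_iff_mul_eq] at ha
    have := b₁.mul (hasBlock_zHom k l a)
    rw [Matrix.mul_smul, mul_one, ha] at this
    exact n₃ a (b₂.unique this)
  · obtain ⟨a, rfl | rfl | rfl⟩ := hc T hT
    · exact Or.inl ⟨a, rfl⟩
    · exact Or.inr (Or.inl ⟨a, (inv_mul_cancel_left _ _).symm⟩)
    · exact Or.inr (Or.inr ⟨a, (inv_mul_cancel_left _ _).symm⟩)

/-- The lift is `(u, v) ↦ (Su, v + Nu)`. The map `N` absorbs an additive discrepancy between `F ∘ S`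
and `F`, and its homogeneity makes the lift commute with `Z`. -/
theorem exists_mem_CF_of_matAct {k l : ℕ} {F : M × M → M × M} (P : Subgroup Mˣ)
    {S : Matrix (Fin 2) (Fin 2) M} (hS : S.det ≠ 0) (N : M × M →ₗ[ZMod 2] M × M)
    (hN : ∀ a x y : M, N (a * x, a * y) =
      (a ^ (2 ^ k + 1) * (N (x, y)).1, a ^ (2 ^ l + 1) * (N (x, y)).2))
    (hF : ∀ u, F (matAct S u) = F u + N u) :
    ∃ T ∈ CF P k l F, HasBlock T S ∧ ∀ u v, T (u, v) = (matAct S u, v + N u) := by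
  let f : (M × M) × (M × M) →ₗ[ZMod 2] (M × M) × (M × M) :=
    (matAct S ∘ₗ LinearMap.fst _ _ _).prod (LinearMap.snd _ _ _ + N ∘ₗ LinearMap.fst _ _ _)
  have hf : ∀ u v, f (u, v) = (matAct S u, v + N u) := fun u v => rfl
  have hinj : Function.Injective f := by
    rintro ⟨u, v⟩ ⟨u', v'⟩ h
    rw [hf, hf, Prod.mk.injEq] at h
    obtain rfl := matAct_injective hS h.1
    rw [add_right_cancel h.2]
  let T : GLFF M := LinearEquiv.ofBijective f ⟨hinj, Finite.surjective_of_injective hinj⟩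
  have hT : ∀ u v, T (u, v) = (matAct S u, v + N u) := hf
  have hb : HasBlock T S := fun u v => by rw [hT]
  refine ⟨T, ⟨?_, mem_AutEL hb fun u => by rw [hT, hF]⟩, hb, hT⟩
  refine Subgroup.mem_centralizer_iff.2 ?_
  rintro _ ⟨a, -, rfl⟩
  ext1 ⟨⟨x, y⟩, ⟨z, w⟩⟩
  have e : ∀ x y z w, T ((x, y), (z, w)) = ((S 0 0 * x + S 0 1 * y, S 1 0 * x + S 1 1 * y),
      (z + (N (x, y)).1, w + (N (x, y)).2)) := fun x y z w => hT _ _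
  rw [LinearEquiv.mul_apply, LinearEquiv.mul_apply, e, zHom_apply, zHom_apply, e, hN]
  simp only [Prod.mk.injEq]
  refine ⟨⟨?_, ?_⟩, ?_, ?_⟩ <;> ring

omit [Finite M] in
theorem exists_rows (L : M × M →ₗ[ZMod 2] M × M) :
    ∃ A B C D : M →ₗ[ZMod 2] M, ∀ z w, L (z, w) = (A z + B w, C z + D w) := by
  refine ⟨LinearMap.fst _ _ _ ∘ₗ L ∘ₗ LinearMap.inl _ _ _,
    LinearMap.fst _ _ _ ∘ₗ L ∘ₗ LinearMap.inr _ _ _,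
    LinearMap.snd _ _ _ ∘ₗ L ∘ₗ LinearMap.inl _ _ _,
    LinearMap.snd _ _ _ ∘ₗ L ∘ₗ LinearMap.inr _ _ _, fun z w => ?_⟩
  have e : ((z, w) : M × M) = (z, 0) + (0, w) := by simp
  rw [e, map_add]
  rfl

theorem spanningGraph_of_twistedForm {φ ψ : Gal(M/ZMod 2)} (h1 : φ * φ ≠ 1) (h2 : φ ≠ ψ)
    (h3 : φ * ψ ≠ 1) {b c d a' b' c' d' : M} (h0 : b' ≠ 0 ∨ c' ≠ 0)
    (h4 : b' = 0 ∨ c' = 0 ∨ ψ * ψ ≠ 1) {F : M × M → M × M}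
    (hF : F = fun v => (twistedForm φ 1 b c d v.1 v.2, twistedForm ψ a' b' c' d' v.1 v.2)) :
    SpanningGraph F := by
  refine spanningGraph_of_rows fun N L L' H => ?_
  subst hF
  have hL := linear_eq_zero_of_relation h1 h2 h3 H
  refine ⟨hL, linear_eq_zero_of_single_relation h0 h4 (N := N) (a := a') (d := d') fun x y => ?_⟩
  simpa [hL] using H x y

end Index

/-! ### Constraints on the blocks -/

section Families

variable {M : Type*} [Field M] [Finite M] [Algebra (ZMod 2) M]

/-- The block of an element of `C_F` maps the first component of `F` to a multiple of it. -/
theorem semi_invariant_of_fst {φ ψ : Gal(M/ZMod 2)} (h1 : φ * φ ≠ 1) (h2 : φ ≠ ψ)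
    (h3 : φ * ψ ≠ 1) {b c d a' b' c' d' : M} {F : M × M → M × M}
    (hF : F = fun v => (twistedForm φ 1 b c d v.1 v.2, twistedForm ψ a' b' c' d' v.1 v.2))
    {S : Matrix (Fin 2) (Fin 2) M} {N L : M × M →ₗ[ZMod 2] M × M}
    (H : ∀ u, F (matAct S u) = N u + L (F u)) :
    ∃ t, twistedForm φ 1 b c d (S 0 0) (S 1 0) = t * 1 ∧
      crossL φ 1 b c d (S 0 0) (S 0 1) (S 1 0) (S 1 1) = t * b ∧
      crossR φ 1 b c d (S 0 0) (S 0 1) (S 1 0) (S 1 1) = t * c ∧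
      twistedForm φ 1 b c d (S 0 1) (S 1 1) = t * d := by
  subst hF
  obtain ⟨A, B, C, D, hL⟩ := exists_rows L
  have := twistedForm_semi_invariant h1 h2 h3 (N := LinearMap.fst _ _ _ ∘ₗ N) (L := A) (L' := B)
    (b := b) (c := c) (d := d) (a' := a') (b' := b') (c' := c') (d' := d')
    (α := S 0 0) (β := S 0 1) (γ := S 1 0) (δ := S 1 1) fun x y => by
      have := congrArg Prod.fst (H (x, y))
      simpa [matAct_apply, hL, add_assoc] using this
  exact ⟨_, (mul_one _).symm, this.2⟩

/-- The block of an element of `C_F` maps the second component of `F` to a multiple of it. -/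
theorem semi_invariant_of_snd {φ ψ : Gal(M/ZMod 2)} (h1 : ψ * ψ ≠ 1) (h2 : ψ ≠ φ)
    (h3 : ψ * φ ≠ 1) {a b c d b' c' d' : M} {F : M × M → M × M}
    (hF : F = fun v => (twistedForm φ a b c d v.1 v.2, twistedForm ψ 1 b' c' d' v.1 v.2))
    {S : Matrix (Fin 2) (Fin 2) M} {N L : M × M →ₗ[ZMod 2] M × M}
    (H : ∀ u, F (matAct S u) = N u + L (F u)) :
    ∃ t, twistedForm ψ 1 b' c' d' (S 0 0) (S 1 0) = t * 1 ∧
      crossL ψ 1 b' c' d' (S 0 0) (S 0 1) (S 1 0) (S 1 1) = t * b' ∧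
      crossR ψ 1 b' c' d' (S 0 0) (S 0 1) (S 1 0) (S 1 1) = t * c' ∧
      twistedForm ψ 1 b' c' d' (S 0 1) (S 1 1) = t * d' := by
  -- Exchange the two components of `F` and conjugate `L` accordingly.
  refine semi_invariant_of_fst h1 h2 h3 (a' := a) (b' := b) (c' := c) (d' := d)
    (F := fun v => (F v).swap) (by rw [hF]; rfl) (N := (LinearEquiv.prodComm _ _ _).toLinearMap ∘ₗ N)
    (L := (LinearEquiv.prodComm _ _ _).toLinearMap ∘ₗ L ∘ₗ (LinearEquiv.prodComm _ _ _).toLinearMap)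
    fun u => ?_
  simp [H]

/-- If the second component of `F` is `b φ(x) y + c x φ(y)`, then it vanishes at the columns of
the block of an element of `C_F`. -/
theorem columns_eq_zero_of_snd {φ ψ : Gal(M/ZMod 2)} (h1 : ψ ≠ 1) (h2 : ψ ≠ φ)
    (h3 : ψ * φ ≠ 1) {a b c d b' c' : M} {F : M × M → M × M}
    (hF : F = fun v => (twistedForm φ a b c d v.1 v.2, twistedForm ψ 0 b' c' 0 v.1 v.2))
    {S : Matrix (Fin 2) (Fin 2) M} {N L : M × M →ₗ[ZMod 2] M × M}
    (H : ∀ u, F (matAct S u) = N u + L (F u)) :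
    twistedForm ψ 0 b' c' 0 (S 0 0) (S 1 0) = 0 ∧ twistedForm ψ 0 b' c' 0 (S 0 1) (S 1 1) = 0 := by
  subst hF
  obtain ⟨A, B, C, D, hL⟩ := exists_rows L
  refine twistedForm_columns_eq_zero h1 h2 h3 (N := LinearMap.snd _ _ _ ∘ₗ N) (L := D) (L' := C)
    (b := b') (c := c') (a' := a) (b' := b) (c' := c) (d' := d) fun x y => ?_
  have := congrArg Prod.snd (H (x, y))
  simpa [matAct_apply, hL, add_assoc] using this

omit [Finite M] [Algebra (ZMod 2) M] in
theorem eq_diag_or_antidiag {S : Matrix (Fin 2) (Fin 2) M} (hdet : S.det ≠ 0)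
    (h1 : S 0 0 = 0 ∨ S 1 0 = 0) (h2 : S 0 1 = 0 ∨ S 1 1 = 0) :
    (S 0 1 = 0 ∧ S 1 0 = 0 ∧ S 0 0 ≠ 0 ∧ S 1 1 ≠ 0) ∨
      (S 0 0 = 0 ∧ S 1 1 = 0 ∧ S 0 1 ≠ 0 ∧ S 1 0 ≠ 0) := by
  rw [Matrix.det_fin_two] at hdet
  rcases h1 with h1 | h1 <;> rcases h2 with h2 | h2 <;> simp_all

omit [Finite M] in
theorem charTwo : CharP M 2 := charP_of_injective_algebraMap (algebraMap (ZMod 2) M).injective 2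

/-- An index 3 is harmless: `3 = 2² - 1` with `2 < m`, so 3 is not primitive and `p ≠ 3`. -/
theorem conditionC_of_index {m p : ℕ} (hm : 2 < m) (hp : IsPrimitiveDivisor m p)
    {P : Subgroup Mˣ} {k l : ℕ} {F : M × M → M × M}
    (h : CF P k l F = Z M k l ∨
      (Z M k l ≤ CF P k l F ∧ (Z M k l).relIndex (CF P k l F) = 3)) :
    ConditionC p P k l F := by
  rcases h with h | ⟨h1, h2⟩
  · refine ⟨h.ge, ?_⟩
    rw [h, Subgroup.relIndex_self]
    exact hp.1.one_lt.ne' ∘ Nat.dvd_one.1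
  · refine ⟨h1, ?_⟩
    rw [h2, Nat.prime_dvd_prime_iff_eq hp.1 Nat.prime_three]
    rintro rfl
    exact hp.2.2 2 two_pos hm (by norm_num)

omit [Finite M] in
/-- The matrices that stabilize a form without roots up to a scalar. -/
theorem block_cases {φ : Gal(M/ZMod 2)} (hfix : ∀ x, φ x = x → x = 0 ∨ x = 1)
    (hdiv : ∀ x : M, x ≠ 0 → ∃ t, t ≠ 0 ∧ φ t = x * t) {a b c d : M}
    (h0 : ∀ x y, twistedForm φ a b c d x y = 0 → x = 0 ∧ y = 0)
    {S T : Matrix (Fin 2) (Fin 2) M} (hT : IsTwistCentral φ (formMatrix a b c d) T)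
    (hT0 : T ≠ 0) (hT1 : T ≠ 1) (hdet : S.det ≠ 0)
    (H : ∃ t, twistedForm φ a b c d (S 0 0) (S 1 0) = t * a ∧
      crossL φ a b c d (S 0 0) (S 0 1) (S 1 0) (S 1 1) = t * b ∧
      crossR φ a b c d (S 0 0) (S 0 1) (S 1 0) (S 1 1) = t * c ∧
      twistedForm φ a b c d (S 0 1) (S 1 1) = t * d) :
    ∃ s : M, s ≠ 0 ∧ (S = s • (1 : Matrix (Fin 2) (Fin 2) M) ∨ S = s • T ∨ S = s • (T + 1)) := by
  have := charTwo (M := M)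
  obtain ⟨l, e1, e2, e3, e4⟩ := H
  obtain ⟨t, ht, hc⟩ := exists_smul_isTwistCentral hdiv h0 hdet e1 e2 e3 e4
  have hS : S = t⁻¹ • (t • S) := (inv_smul_smul₀ ht S).symm
  have hne : t • S ≠ 0 := by
    intro h
    rw [h, smul_zero] at hS
    exact hdet (by rw [hS, Matrix.det_zero])
  refine ⟨t⁻¹, inv_ne_zero ht, ?_⟩
  rcases isTwistCentral_cases hfix h0 hT hT0 hT1 hc hne with h | h | h
  · exact Or.inl (by rw [← h, ← hS])
  · exact Or.inr (Or.inl (by rw [← h, ← hS]))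
  · exact Or.inr (Or.inr (by rw [← h, ← hS]))

omit [Finite M] [Algebra (ZMod 2) M] in
theorem not_proportional_of_trace [CharP M 2] {T : Matrix (Fin 2) (Fin 2) M} (hT : T.trace = 1) :
    (∀ a : M, T ≠ a • (1 : Matrix (Fin 2) (Fin 2) M)) ∧
    (∀ a : M, T + 1 ≠ a • (1 : Matrix (Fin 2) (Fin 2) M)) ∧ (∀ a : M, T + 1 ≠ a • T) := by
  have h1 : (1 : Matrix (Fin 2) (Fin 2) M).trace = 0 := by
    rw [Matrix.trace_one, Fintype.card_fin]
    exact_mod_cast CharTwo.two_eq_zero (R := M)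
  refine ⟨fun a h => ?_, fun a h => ?_, fun a h => ?_⟩
  · have := congrArg Matrix.trace h
    rw [Matrix.trace_smul, h1, smul_zero, hT] at this
    exact one_ne_zero this
  · have := congrArg Matrix.trace h
    rw [Matrix.trace_smul, Matrix.trace_add, h1, smul_zero, hT, add_zero] at this
    exact one_ne_zero this
  · have h' := congrArg Matrix.trace h
    rw [Matrix.trace_smul, Matrix.trace_add, h1, hT, add_zero, smul_eq_mul, mul_one] at h'
    rw [← h', one_smul] at h
    exact one_ne_zero (add_eq_left.1 h)

end Families

/-! ### Taniguchi functions, cubic forms and Carlet functions -/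

section FamilyTheorems

variable {M : Type*} [Field M] [Finite M] [Algebra (ZMod 2) M]

theorem frob_mul_self_ne_one {m : ℕ} (hm : 2 < m) (hcard : Nat.card M = 2 ^ m) {k : ℕ}
    (hk : Nat.gcd k m = 1) : frob M k * frob M k ≠ 1 := by
  rw [frob_mul, Ne, frob_eq_one_iff hcard]
  intro h
  rw [← two_mul] at h
  have := Nat.le_of_dvd two_pos (Nat.Coprime.dvd_of_dvd_mul_right (Nat.Coprime.symm hk) h)
  omega

/-- A zero of `x ψ(y)` in each column leaves diagonal and antidiagonal blocks. The term `x φ(y)` of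
the first form makes the diagonal entries equal, and the absence of `φ(x) y` rules out antidiagonal
blocks. -/
theorem CF_eq_Z_of_isTaniguchi {m p : ℕ} (hm : 2 < m) (hcard : Nat.card M = 2 ^ m)
    (hp : IsPrimitiveDivisor m p) (P : Sylow p Mˣ) {k l : ℕ} (h2 : frob M k ≠ frob M l)
    (h3 : frob M k * frob M l ≠ 1) {F : M × M → M × M} (hZ : Z M k l ≤ CF (P : Subgroup Mˣ) k l F)
    (hF : IsTaniguchi m k l F) : CF (P : Subgroup Mˣ) k l F = Z M k l := by
  obtain ⟨-, -, hk, hl, d, -, hF⟩ := hF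
  simp only [biproj_eq_twistedForm] at hF
  have h1 := frob_mul_self_ne_one hm hcard hk
  have hl1 : frob M l ≠ 1 := by rwa [hl, two_mul, ← frob_mul]
  have hspan := spanningGraph_of_twistedForm h1 h2 h3 (Or.inr one_ne_zero) (Or.inl rfl) hF
  refine le_antisymm (fun T hT => ?_) hZ
  obtain ⟨S, N, L, hb, hdet, H⟩ := exists_of_mem_CF hcard hp P hT
  obtain ⟨t, e1, e2, e3, -⟩ := semi_invariant_of_fst h1 h2 h3 hF H
  obtain ⟨c1, c2⟩ := columns_eq_zero_of_snd hl1 h2.symm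
    (by rw [frob_mul, add_comm, ← frob_mul]; exact h3) hF H
  have hor : ∀ x y : M, twistedForm (frob M l) 0 0 1 0 x y = 0 → x = 0 ∨ y = 0 := by
    intro x y h
    simpa [twistedForm] using h
  simp only [twistedForm, crossL, crossR] at e1 e2 e3
  rcases eq_diag_or_antidiag hdet (hor _ _ c1) (hor _ _ c2) with ⟨z1, z2, n1, n2⟩ | ⟨z1, z2, n1, n2⟩
  · simp only [z1, z2, map_zero, mul_zero, zero_mul, add_zero, zero_add, one_mul, mul_one] at e1 e3
    rw [← e1, mul_comm] at e3
    have h := (frob M k).injective (mul_right_cancel₀ n1 e3)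
    refine ⟨Units.mk0 _ n1, (eq_zHom_of_hasBlock (a := Units.mk0 _ n1) hspan hZ hT ?_).symm⟩
    convert hb using 1
    ext i j
    fin_cases i <;> fin_cases j <;> simp [z1, z2, h]
  · simp only [z1, z2, map_zero, mul_zero, zero_mul, add_zero, zero_add, one_mul] at e2
    rcases mul_eq_zero.1 e2 with h | h
    · exact absurd ((map_eq_zero _).1 h) n2
    · exact absurd h n1

/-- The forms of the families `F_1` and `F_2` have no roots. -/
theorem cubic_form_no_root {m : ℕ} (hm : 1 < m) (hcard : Nat.card M = 2 ^ m) {k : ℕ}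
    (h3k : Nat.gcd (3 * k) m = 1) (x y : M) (h : twistedForm (frob M k) 1 0 1 1 x y = 0) :
    x = 0 ∧ y = 0 := by
  have h2 : (2 : M) = 0 := (charTwo (M := M)).cast_eq_zero
  have hz : ∀ φ : Gal(M/ZMod 2), ∀ x : M, φ x * x = 0 → x = 0 := by
    intro φ x hx
    simpa using hx
  by_cases hy : y = 0
  · subst hy
    refine ⟨hz (frob M k) x ?_, rfl⟩
    simpa [twistedForm] using h
  exfalso
  obtain ⟨t, rfl⟩ : ∃ t, x = t * y := ⟨x / y, (div_mul_cancel₀ x hy).symm⟩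
  set φ := frob M k with hφ
  have hφy : φ y ≠ 0 := by simpa using hy
  -- A root amounts to `φ(t) = (t + 1) / t`, a Möbius map of order 3 in characteristic two. Hence
  -- `φ³(t) = t`, so `t` is 0 or 1, and neither is a solution.
  have e1 : φ t * t + t + 1 = 0 := by
    refine (mul_eq_zero.1 (?_ : (φ t * t + t + 1) * (φ y * y) = 0)).resolve_right
      (mul_ne_zero hφy hy)
    simp only [twistedForm, map_mul] at h
    linear_combination h
  have e2 : φ (φ t) * φ t + φ t + 1 = 0 := by simpa using congrArg φ e1
  have e3 : φ (φ (φ t)) * φ (φ t) + φ (φ t) + 1 = 0 := by simpa using congrArg φ e2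
  have ht : t ≠ 0 := by
    rintro rfl
    simp at e1
  have hφt : φ t ≠ 0 := by simpa using ht
  have hφφt : φ (φ t) ≠ 0 := by simpa using ht
  have h3 : φ (φ (φ t)) = t := by
    apply mul_right_cancel₀ hφφt
    apply mul_right_cancel₀ hφt
    linear_combination φ t * e3 - e2 - t * e2 + e1
  have h4 : frob M (3 * k) t = t := by
    rw [show 3 * k = k + (k + k) by ring, ← frob_mul, ← frob_mul]
    exact h3
  rcases frob_fixed hm hcard h3k t h4 with rfl | rfl
  · exact ht rfl
  · rw [map_one] at e1
    have : (1 : M) = 0 := by linear_combination e1 - h2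
    exact one_ne_zero this

theorem CF_eq_of_cubic_form {m p : ℕ} (hm : 2 < m) (hcard : Nat.card M = 2 ^ m)
    (hp : IsPrimitiveDivisor m p) (P : Sylow p Mˣ) {k l : ℕ} (h2 : frob M k ≠ frob M l)
    (h3 : frob M k * frob M l ≠ 1) {F : M × M → M × M} (hZ : Z M k l ≤ CF (P : Subgroup Mˣ) k l F)
    (h3k : Nat.gcd (3 * k) m = 1) {a b c d : M} (h0 : b ≠ 0 ∨ c ≠ 0)
    (h4 : b = 0 ∨ c = 0 ∨ frob M l * frob M l ≠ 1)
    (hF : F = fun v => (biproj k 1 0 1 1 v.1 v.2, biproj l a b c d v.1 v.2))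
    (hinv : ∀ x y : M, biproj l a b c d (x + y) x = biproj l a b c d x y) :
    (CF (P : Subgroup Mˣ) k l F : Set (GLFF M)) =
        (Z M k l : Set (GLFF M)) ∪ setA M k l ∪ setB M k l ∧
      (Z M k l).relIndex (CF (P : Subgroup Mˣ) k l F) = 3 := by
  have := charTwo (M := M)
  have htwo : (2 : M) = 0 := CharTwo.two_eq_zero
  have hm1 : 1 < m := by omega
  have hk : Nat.gcd k m = 1 := Nat.Coprime.coprime_mul_left h3k
  have h1 := frob_mul_self_ne_one hm hcard hk
  have hfix := frob_fixed hm1 hcard hk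
  have hinv' : ∀ u : M × M, F (u.1 + u.2, u.1) = F u := by
    rintro ⟨x, y⟩
    simp only [hF, hinv]
    congr 1
    simp only [biproj_eq_twistedForm, twistedForm, map_add]
    linear_combination (frob M k x * x + frob M k x * y) * htwo
  simp only [biproj_eq_twistedForm] at hF
  have hspan := spanningGraph_of_twistedForm h1 h2 h3 h0 h4 hF
  -- This matrix has order 3 and entries in the prime field, and the form matrix is `K + 1 = K²`, so
  -- it commutes with the semilinear map.
  let K : Matrix (Fin 2) (Fin 2) M := !![1, 1; 1, 0]
  have hK : IsTwistCentral (frob M k) (formMatrix 1 0 1 1) K := by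
    unfold IsTwistCentral formMatrix
    ext i j
    fin_cases i <;> fin_cases j <;> simp [K, Matrix.mul_apply, Fin.sum_univ_two]
    all_goals first | linear_combination htwo | linear_combination -htwo
  have hKtr : K.trace = 1 := by simp [K, Matrix.trace_fin_two]
  have hK0 : K ≠ 0 := by
    intro h
    simpa [K] using congr_fun₂ h 0 0
  have hK1 : K ≠ 1 := by
    intro h
    simpa [K] using congr_fun₂ h 0 1
  have hact : ∀ x y : M, matAct K (x, y) = (x + y, x) := by
    intro x y
    simp [matAct_apply, K]
  have hact' : ∀ x y : M, matAct (K + 1) (x, y) = (y, x + y) := by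
    intro x y
    simp [matAct_apply, K, CharTwo.add_self_eq_zero]
  obtain ⟨T₁, hT₁, hb₁, hv₁⟩ := exists_mem_CF_of_matAct (k := k) (l := l) (F := F)
    (P : Subgroup Mˣ) (S := K) (by simp [K, Matrix.det_fin_two]) 0 (by intros; ext <;> simp)
    (by
      rintro ⟨x, y⟩
      rw [hact, LinearMap.zero_apply, add_zero]
      exact hinv' (x, y))
  obtain ⟨T₂, hT₂, hb₂, hv₂⟩ := exists_mem_CF_of_matAct (k := k) (l := l) (F := F)
    (P : Subgroup Mˣ) (S := K + 1)
    (by simp [K, Matrix.det_fin_two, CharTwo.add_self_eq_zero]) 0 (by intros; ext <;> simp)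
    (by
      rintro ⟨x, y⟩
      rw [hact', LinearMap.zero_apply, add_zero]
      -- Since `K + 1 = K²`, its invariance is that of `K` applied twice.
      have e := hinv' (x + y, x)
      rw [hinv' (x, y)] at e
      rw [← e]
      congr 2
      linear_combination -x * htwo)
  obtain ⟨n1, n2, n3⟩ := not_proportional_of_trace hKtr
  obtain ⟨hcos, hidx⟩ := cosets_of_blocks hspan hZ hT₁ hT₂ hb₁ hb₂ n1 n2 n3 fun T hT => by
    obtain ⟨S, N, L, hb, hdet, H⟩ := exists_of_mem_CF hcard hp P hT
    exact ⟨S, hb, block_cases hfix (exists_frob_eq_mul hfix) (cubic_form_no_root hm1 hcard h3k)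
      hK hK0 hK1 hdet (semi_invariant_of_fst h1 h2 h3 hF H)⟩
  have hA : ∀ (a : Mˣ) (x y z w : M), (T₁ * zHom k l a) ((x, y), (z, w)) =
      ((a * x + a * y, a * x), (a ^ (2 ^ k + 1) * z, a ^ (2 ^ l + 1) * w)) := by
    intro a x y z w
    rw [LinearEquiv.mul_apply, zHom_apply, hv₁, hact]
    simp
  have hB : ∀ (a : Mˣ) (x y z w : M), (T₂ * zHom k l a) ((x, y), (z, w)) =
      ((a * y, a * x + a * y), (a ^ (2 ^ k + 1) * z, a ^ (2 ^ l + 1) * w)) := by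
    intro a x y z w
    rw [LinearEquiv.mul_apply, zHom_apply, hv₂, hact']
    simp
  refine ⟨Set.Subset.antisymm (fun T hT => ?_) ?_, hidx⟩
  · obtain ⟨a, rfl | rfl | rfl⟩ := hcos T hT
    · exact Or.inl (Or.inl ⟨a, rfl⟩)
    · exact Or.inl (Or.inr ⟨a, hA a⟩)
    · exact Or.inr ⟨a, hB a⟩
  · rintro T ((hT | ⟨a, ha⟩) | ⟨a, ha⟩)
    · exact hZ hT
    · rw [show T = T₁ * zHom k l a by
        ext1 ⟨⟨x, y⟩, ⟨z, w⟩⟩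
        rw [ha, hA]]
      exact mul_mem hT₁ (hZ ⟨a, rfl⟩)
    · rw [show T = T₂ * zHom k l a by
        ext1 ⟨⟨x, y⟩, ⟨z, w⟩⟩
        rw [ha, hB]]
      exact mul_mem hT₂ (hZ ⟨a, rfl⟩)

/-- Here the rootless form is the second component, while `xy` is a twisted form for the trivial
automorphism. Every stabilizing matrix lifts: having determinant 1, it changes `xy` only by an
additive map. -/
theorem relIndex_of_isCarlet {m p : ℕ} (hm : 2 < m) (hcard : Nat.card M = 2 ^ m)
    (hp : IsPrimitiveDivisor m p) (P : Sylow p Mˣ) {k l : ℕ}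
    {F : M × M → M × M} (hZ : Z M k l ≤ CF (P : Subgroup Mˣ) k l F) (hF : IsCarlet m k l F) :
    (Z M k l).relIndex (CF (P : Subgroup Mˣ) k l F) = 3 := by
  obtain ⟨rfl, hl0, hlm, hl, b, c, d, hroot, hF⟩ := hF
  have := charTwo (M := M)
  have htwo : (2 : M) = 0 := CharTwo.two_eq_zero
  have hm1 : 1 < m := by omega
  have h1 := frob_mul_self_ne_one hm hcard hl
  have hl1 : frob M l ≠ 1 := fun h => h1 (by rw [h, one_mul])
  have hfix := frob_fixed hm1 hcard hl
  have hF' : F = fun v => (twistedForm (1 : Gal(M/ZMod 2)) 0 1 0 0 v.1 v.2,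
      twistedForm (frob M l) 1 b c d v.1 v.2) := by
    rw [hF]
    funext v
    simp [biproj_eq_twistedForm, twistedForm]
  have hspan : SpanningGraph F := by
    refine spanningGraph_of_rows fun N L L' H => ?_
    subst hF'
    have hL' : L' = 0 := linear_eq_zero_of_relation h1 hl1 (by rwa [mul_one]) (N := N)
      fun x y => by
        rw [← H x y]
        exact add_right_comm _ _ _
    refine ⟨linear_eq_zero_of_single_relation (φ := (1 : Gal(M/ZMod 2))) (a := 0) (b := 1) (c := 0)
      (d := 0) (Or.inl one_ne_zero) (Or.inr (Or.inl rfl)) (N := N) fun x y => ?_, hL'⟩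
    simpa [hL'] using H x y
  have h0 : ∀ x y : M, twistedForm (frob M l) 1 b c d x y = 0 → x = 0 ∧ y = 0 := by
    intro x y h
    rw [← biproj_eq_twistedForm] at h
    by_cases hy : y = 0
    · subst hy
      simpa [biproj] using h
    exfalso
    obtain ⟨t, rfl⟩ : ∃ t, x = t * y := ⟨x / y, (div_mul_cancel₀ x hy).symm⟩
    refine hroot t ((mul_eq_zero.1 (?_ : _ * y ^ (2 ^ l + 1) = 0)).resolve_right
      (pow_ne_zero _ hy))
    simp only [biproj, mul_pow, pow_succ] at h ⊢
    linear_combination h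
  obtain ⟨K, hK, hK0, hK1⟩ := exists_isTwistCentral
    (orderOf_pos (frob M l)) h0
  have hKtr := trace_eq_one_of_isTwistCentral hfix h0 hK hK0 hK1
  obtain ⟨n1, n2, n3⟩ := not_proportional_of_trace hKtr
  have hlift : ∀ S : Matrix (Fin 2) (Fin 2) M,
      IsTwistCentral (frob M l) (formMatrix 1 b c d) S → S ≠ 0 →
      ∃ T ∈ CF (P : Subgroup Mˣ) 0 l F, HasBlock T S := by
    intro S hS hS0
    have hdet := det_eq_one_of_isTwistCentral hfix h0 hS hS0
    have hsub := twistedForm_subst_of_isTwistCentral hS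
    -- The product of the two rows of `S(x, y)` is `xy` plus terms in `x²` and `y²`, which are
    -- additive and go into `N`.
    let N : M × M →ₗ[ZMod 2] M × M :=
      { toFun := fun u => (S 0 0 * S 1 0 * frob M 1 u.1 + S 0 1 * S 1 1 * frob M 1 u.2, 0)
        map_add' := fun u v => by
          ext
          · simp
            ring
          · simp
        map_smul' := fun t u => by
          ext <;> simp }
    obtain ⟨T, hT, hb, -⟩ := exists_mem_CF_of_matAct (k := 0) (l := l) (F := F)
      (P : Subgroup Mˣ) (S := S) (by rw [hdet]; exact one_ne_zero) N
      (by
        intro a x y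
        ext
        · simp [N, frob_apply]
          ring
        · simp [N])
      (by
        rintro ⟨x, y⟩
        rw [hF']
        ext
        · rw [Matrix.det_fin_two] at hdet
          simp [N, frob_apply, twistedForm, matAct_apply]
          linear_combination x * y * hdet + x * y * S 0 1 * S 1 0 * htwo
        · simp only [matAct_apply, hsub, hdet, one_mul]
          simp [N])
    exact ⟨T, hT, hb⟩
  have hK10 : K + 1 ≠ 0 := fun h => n2 0 (by rw [h, zero_smul])
  obtain ⟨T₁, hT₁, hb₁⟩ := hlift K hK hK0
  obtain ⟨T₂, hT₂, hb₂⟩ := hlift (K + 1) (hK.add .one) hK10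
  refine (cosets_of_blocks hspan hZ hT₁ hT₂ hb₁ hb₂ n1 n2 n3 fun T hT => ?_).2
  obtain ⟨S, N, L, hb, hdet, H⟩ := exists_of_mem_CF hcard hp P hT
  exact ⟨S, hb, block_cases hfix (exists_frob_eq_mul hfix) h0 hK hK0 hK1 hdet
    (semi_invariant_of_snd h1 hl1 (by rwa [mul_one]) hF' H)⟩

end FamilyTheorems

/-! ### Cube roots of unity and diagonal blocks -/

section DiagonalFamilies

variable {M : Type*} [Field M] [Finite M] [Algebra (ZMod 2) M]

theorem three_dvd_two_pow_add_one {k : ℕ} (hk : Odd k) : 3 ∣ 2 ^ k + 1 := by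
  simpa using hk.nat_add_dvd_pow_add_pow 2 1

theorem three_dvd_two_pow_sub_one {l : ℕ} (hl : Even l) : 3 ∣ 2 ^ l - 1 := by
  obtain ⟨n, rfl⟩ := hl
  rw [← two_mul, pow_mul]
  simpa using Nat.sub_dvd_pow_sub_pow 4 1 n

theorem odd_of_gcd_eq_one {k m : ℕ} (hm : Even m) (hk : Nat.gcd k m = 1) : Odd k := by
  rw [← Nat.not_even_iff_odd]
  intro h
  have := Nat.dvd_gcd h.two_dvd hm.two_dvd
  rw [hk] at this
  omega

omit [Algebra (ZMod 2) M] in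
-- The order of `ω` divides both `2^(2k) - 1` and `2^m - 1`, hence `2^gcd(2k, m) - 1 = 3`.
theorem pow_three_eq_one_of_norm {m : ℕ} (hcard : Nat.card M = 2 ^ m) (hm : Even m) {k : ℕ}
    (hk : Nat.gcd k m = 1) {ω : M} (h0 : ω ≠ 0) (h : ω ^ (2 ^ k + 1) = 1) : ω ^ 3 = 1 := by
  have h1 : orderOf ω ∣ 2 ^ (2 * k) - 1 := by
    refine (orderOf_dvd_of_pow_eq_one h).trans ⟨2 ^ k - 1, ?_⟩
    rw [mul_comm 2 k, pow_mul]
    simpa using Nat.sq_sub_sq (2 ^ k) 1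
  have h2 : orderOf ω ∣ 2 ^ m - 1 := by
    rw [orderOf_dvd_iff_pow_eq_one, ← hcard]
    have := Fintype.ofFinite M
    rw [Nat.card_eq_fintype_card]
    exact FiniteField.pow_card_sub_one_eq_one ω h0
  have h3 := Nat.dvd_gcd h1 h2
  have h4 : Nat.gcd (2 * k) m = 2 := by
    rw [Nat.Coprime.gcd_mul_right_cancel 2 hk]
    exact Nat.gcd_eq_left hm.two_dvd
  rw [Nat.pow_sub_one_gcd_pow_sub_one, h4] at h3
  exact orderOf_dvd_iff_pow_eq_one.1 h3

omit [Algebra (ZMod 2) M] in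
theorem exists_primitive_cube_root {m : ℕ} (hcard : Nat.card M = 2 ^ m) (hm : Even m) :
    ∃ ω : Mˣ, ω ^ 3 = 1 ∧ ω ≠ 1 := by
  have : Fact (Nat.Prime 3) := ⟨Nat.prime_three⟩
  obtain ⟨ω, hω⟩ := exists_prime_orderOf_dvd_card' (G := Mˣ) 3 (by
    rw [Nat.card_units, hcard]
    exact three_dvd_two_pow_sub_one hm)
  refine ⟨ω, hω ▸ pow_orderOf_eq_one ω, fun h => ?_⟩
  rw [h, orderOf_one] at hω
  omega

omit [Finite M] [Algebra (ZMod 2) M] in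
theorem cube_root_cases {ω : Mˣ} (h3 : ω ^ 3 = 1) (h1 : ω ≠ 1) {x : Mˣ} (hx : x ^ 3 = 1) :
    x = 1 ∨ x = ω ∨ x = ω ^ 2 := by
  have e3 : (ω : M) ^ 3 = 1 := by rw [← Units.val_pow_eq_pow_val, h3, Units.val_one]
  have ex : (x : M) ^ 3 = 1 := by rw [← Units.val_pow_eq_pow_val, hx, Units.val_one]
  have n1 : (ω : M) - 1 ≠ 0 := fun h => h1 (Units.ext (sub_eq_zero.1 h))
  have es : (ω : M) ^ 2 + ω + 1 = 0 := by
    refine (mul_eq_zero.1 (?_ : ((ω : M) - 1) * _ = 0)).resolve_left n1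
    linear_combination e3
  have hprod : ((x : M) - 1) * ((x - ω) * (x - ω ^ 2)) = 0 := by
    linear_combination ex - e3 + ((x : M) * ω - x ^ 2) * es
  rcases mul_eq_zero.1 hprod with h | h
  · exact Or.inl (Units.ext (sub_eq_zero.1 h))
  · rcases mul_eq_zero.1 h with h | h
    · exact Or.inr (Or.inl (Units.ext (sub_eq_zero.1 h)))
    · refine Or.inr (Or.inr (Units.ext ?_))
      rw [Units.val_pow_eq_pow_val]
      exact sub_eq_zero.1 h

omit [Finite M] [Algebra (ZMod 2) M] in
theorem mem_F4Units_iff {ω : Mˣ} : ω ∈ F4Units M ↔ ω ^ 3 = 1 := by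
  unfold F4Units
  rw [Set.mem_ofPred_eq, Units.ext_iff, Units.val_pow_eq_pow_val, Units.val_one]
  constructor
  · intro h
    apply mul_right_cancel₀ ω.ne_zero
    rw [one_mul, ← pow_succ, h]
  · intro h
    rw [pow_succ, h, one_mul]

theorem diag_mem_CF (P : Subgroup Mˣ) {k l : ℕ} {b c d : M} {F : M × M → M × M}
    (hF : F = fun v => (biproj k 1 0 0 d v.1 v.2, biproj l 0 b c 0 v.1 v.2)) {ω : Mˣ}
    (h1 : (ω : M) ^ (2 ^ k + 1) = 1) (h2 : b * (ω : M) ^ 2 ^ l = b * ω) :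
    diag 1 ω 1 (ω ^ 2 ^ l) ∈ CF P k l F := by
  refine ⟨?_, mem_AutEL (hasBlock_diag _ _ _ _) ?_⟩
  · refine Subgroup.mem_centralizer_iff.2 ?_
    rintro _ ⟨a, -, rfl⟩
    ext1 ⟨⟨x, y⟩, ⟨z, w⟩⟩
    rw [LinearEquiv.mul_apply, LinearEquiv.mul_apply, zHom_apply, diag_apply, diag_apply,
      zHom_apply]
    simp only [Prod.mk.injEq]
    refine ⟨⟨?_, ?_⟩, ?_, ?_⟩ <;> ring
  · rintro ⟨x, y⟩
    subst hF
    rw [diag_apply, matAct_apply]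
    simp only [biproj, Matrix.of_apply, Matrix.cons_val', Matrix.cons_val_zero,
      Matrix.cons_val_one, Matrix.cons_val_fin_one, Units.val_one, one_mul, zero_mul, add_zero,
      zero_add, mul_pow, h1, Units.val_pow_eq_pow_val]
    congr 1
    linear_combination x ^ 2 ^ l * y * h2

omit [Finite M] [Algebra (ZMod 2) M] in
/-- In characteristic two, `d` is a norm `φ(e) e` if `d ^ 2` is. -/
theorem exists_norm_of_sq {k : ℕ} (hk : 0 < k) {d e : M} (h : d ^ 2 = e ^ (2 ^ k + 1)) :
    ∃ e, d = e ^ (2 ^ k + 1) := by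
  obtain ⟨n, rfl⟩ : ∃ n, k = n + 1 := ⟨k - 1, by omega⟩
  by_cases hd : d = 0
  · exact ⟨0, by rw [hd, zero_pow (by positivity)]⟩
  have he : e ≠ 0 := by
    rintro rfl
    rw [zero_pow (by positivity)] at h
    exact hd (by simpa using h)
  -- With `q = 2^(n+1)`, raising the hypothesis to the power `2^n` gives `d^q = (e^(2^n))^(q+1)`;
  -- dividing `d^(q+1)` by it leaves `d`.
  refine ⟨d / e ^ 2 ^ n, ?_⟩
  have h' : d ^ 2 ^ (n + 1) = (e ^ 2 ^ n) ^ (2 ^ (n + 1) + 1) := by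
    rw [pow_succ' 2 n, pow_mul, h, ← pow_mul, ← pow_mul, pow_succ' 2 n, mul_comm]
  rw [div_pow, ← h', pow_succ d, mul_div_cancel_left₀ _ (pow_ne_zero _ hd)]

/-- The common mechanism for Zhou–Pott and `F_4`: the second form vanishes only on the axes, so
blocks are diagonal or antidiagonal, and `d` not being a `(q+1)`-th power excludes the latter. -/
theorem CF_eq_of_diagonal {m p : ℕ} (hm : 2 < m) (hme : Even m) (hcard : Nat.card M = 2 ^ m)
    (hp : IsPrimitiveDivisor m p) (P : Sylow p Mˣ) {k l : ℕ} (hk0 : 0 < k)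
    (hk : Nat.gcd k m = 1) (h2 : frob M k ≠ frob M l) (h3 : frob M k * frob M l ≠ 1)
    (hl1 : frob M l ≠ 1) {F : M × M → M × M} (hZ : Z M k l ≤ CF (P : Subgroup Mˣ) k l F)
    {b c d : M} (h0 : b ≠ 0 ∨ c ≠ 0) (h4 : b = 0 ∨ c = 0 ∨ frob M l * frob M l ≠ 1)
    (hd0 : d ≠ 0) (hd : ∀ e : M, d ≠ e ^ (2 ^ k + 1))
    (hg : ∀ x y, twistedForm (frob M l) 0 b c 0 x y = 0 → x = 0 ∨ y = 0)
    (hb : ∀ ω : M, ω ^ 3 = 1 → b * ω ^ 2 ^ l = b * ω)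
    (hF : F = fun v => (biproj k 1 0 0 d v.1 v.2, biproj l 0 b c 0 v.1 v.2)) :
    (CF (P : Subgroup Mˣ) k l F : Set (GLFF M)) = ⋃ ω ∈ F4Units M, Zω k l ω ∧
      (Z M k l).relIndex (CF (P : Subgroup Mˣ) k l F) = 3 := by
  have h1 := frob_mul_self_ne_one hm hcard hk
  have hodd := odd_of_gcd_eq_one hme hk
  have hF' := hF
  simp only [biproj_eq_twistedForm] at hF'
  have hspan := spanningGraph_of_twistedForm h1 h2 h3 h0 h4 hF'
  have hmem : ∀ ω : Mˣ, ω ^ 3 = 1 → diag 1 ω 1 (ω ^ 2 ^ l) ∈ CF (P : Subgroup Mˣ) k l F := by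
    intro ω hω
    have hω' : (ω : M) ^ 3 = 1 := by
      rw [← Units.val_pow_eq_pow_val, hω, Units.val_one]
    refine diag_mem_CF _ hF ?_ (hb _ hω')
    obtain ⟨n, hn⟩ := three_dvd_two_pow_add_one hodd
    rw [hn, pow_mul, hω', one_pow]
  obtain ⟨ω, hω3, hω1⟩ := exists_primitive_cube_root hcard hme
  have hω6 : (ω ^ 2) ^ 3 = 1 := by rw [← pow_mul, mul_comm, pow_mul, hω3, one_pow]
  have hblock : ∀ T ∈ CF (P : Subgroup Mˣ) k l F, ∃ S, HasBlock T S ∧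
      ∃ a x : Mˣ, x ^ 3 = 1 ∧ S = (a : M) • !![((1 : Mˣ) : M), 0; 0, (x : M)] := by
    intro T hT
    obtain ⟨S, N, L, hb, hdet, H⟩ := exists_of_mem_CF hcard hp P hT
    refine ⟨S, hb, ?_⟩
    obtain ⟨t, e1, -, -, e4⟩ := semi_invariant_of_fst h1 h2 h3 hF' H
    obtain ⟨c1, c2⟩ := columns_eq_zero_of_snd hl1 h2.symm
      (by rw [frob_mul, add_comm, ← frob_mul]; exact h3) hF' H
    rw [← biproj_eq_twistedForm, biproj] at e1 e4
    rcases eq_diag_or_antidiag hdet (hg _ _ c1) (hg _ _ c2) with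
      ⟨z1, z2, n1, n2⟩ | ⟨z1, z2, n1, n2⟩
    · have hp0 : (0 : M) ^ (2 ^ k + 1) = 0 := zero_pow (by positivity)
      simp only [z1, z2, hp0, mul_zero, zero_mul, add_zero, zero_add, one_mul, mul_one] at e1 e4
      -- The coefficients 1 and `d` are scaled by the same factor.
      have hr : (S 1 1 / S 0 0) ^ (2 ^ k + 1) = 1 := by
        rw [div_pow, div_eq_one_iff_eq (pow_ne_zero _ n1), e1]
        apply mul_left_cancel₀ hd0
        rw [e4, mul_comm]
      have hr3 := pow_three_eq_one_of_norm hcard hme hk (div_ne_zero n2 n1) hr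
      refine ⟨Units.mk0 _ n1, Units.mk0 _ (div_ne_zero n2 n1), Units.ext (by simpa using hr3), ?_⟩
      ext i j
      fin_cases i <;> fin_cases j <;> simp [z1, z2]
      field_simp
    · exfalso
      have hp0 : (0 : M) ^ (2 ^ k + 1) = 0 := zero_pow (by positivity)
      simp only [z1, z2, hp0, mul_zero, zero_mul, add_zero, zero_add, one_mul, mul_one] at e1 e4
      -- An antidiagonal block exchanges the coefficients 1 and `d` up to a factor, so `d²` is a
      -- `(q+1)`-th power, and then so is `d`.
      obtain ⟨e, he⟩ := exists_norm_of_sq (k := k) hk0 (d := d) (e := S 0 1 / S 1 0) (by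
        rw [div_pow, eq_div_iff (pow_ne_zero _ n2), e4, ← e1]
        ring)
      exact hd e he
  have hdiagZ : ∀ a x : Mˣ, diag 1 x 1 (x ^ 2 ^ l) * zHom k l a =
      diag a (a * x) (a ^ (2 ^ k + 1)) (a ^ (2 ^ l + 1) * x ^ 2 ^ l) := by
    intro a x
    ext1 ⟨⟨u, v⟩, ⟨z, w⟩⟩
    rw [LinearEquiv.mul_apply, zHom_apply, diag_apply, diag_apply]
    simp only [Prod.mk.injEq, Units.val_one, Units.val_mul, Units.val_pow_eq_pow_val]
    refine ⟨⟨?_, ?_⟩, ?_, ?_⟩ <;> ring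
  have hscalar : ∀ a x : M, (a • (1 : Matrix (Fin 2) (Fin 2) M)) = !![1, 0; 0, x] → x = 1 := by
    intro a x h
    have e1 := congr_fun₂ h 0 0
    have e2 := congr_fun₂ h 1 1
    simp at e1 e2
    rw [← e2, e1]
  refine ⟨Set.Subset.antisymm (fun T hT => ?_) ?_, ?_⟩
  · obtain ⟨S, hS, a, x, hx, rfl⟩ := hblock T hT
    refine Set.mem_biUnion (mem_F4Units_iff.2 hx) ⟨a, ?_⟩
    rw [← hdiagZ]
    exact eq_mul_zHom_of_hasBlock hspan hZ hT (hmem x hx) (hasBlock_diag _ _ _ _) hS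
  · refine Set.iUnion₂_subset fun x hx => ?_
    rintro _ ⟨a, rfl⟩
    rw [← hdiagZ]
    exact mul_mem (hmem x (mem_F4Units_iff.1 hx)) (hZ ⟨a, rfl⟩)
  · refine (cosets_of_blocks hspan hZ (hmem ω hω3) (hmem _ hω6) (hasBlock_diag _ _ _ _)
      (hasBlock_diag _ _ _ _) (fun a h => hω1 ?_) (fun a h => hω1 ?_) (fun a h => hω1 ?_)
      fun T hT => ?_).2
    · exact Units.ext (hscalar a _ h.symm)
    · have h' := hscalar a _ h.symm
      have h' : ω ^ 2 = 1 := Units.ext h'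
      rwa [pow_succ, h', one_mul] at hω3
    · have e1 := congr_fun₂ h 0 0
      have e2 := congr_fun₂ h 1 1
      simp at e1 e2
      rw [← e1, one_mul, sq, mul_eq_left₀ ω.ne_zero] at e2
      exact Units.ext e2
    · obtain ⟨S, hS, a, x, hx, rfl⟩ := hblock T hT
      refine ⟨_, hS, a, a.ne_zero, ?_⟩
      rcases cube_root_cases hω3 hω1 hx with rfl | rfl | rfl
      · left
        congr 1
        ext i j
        fin_cases i <;> fin_cases j <;> simp
      · exact Or.inr (Or.inl rfl)
      · exact Or.inr (Or.inr rfl)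

end DiagonalFamilies

/-! ### Zhou–Pott functions, the remaining families and the assembly -/

section SpecialDiagonalFamilies

variable {M : Type*} [Field M] [Finite M] [Algebra (ZMod 2) M]

theorem CF_eq_of_isZhouPott {m p : ℕ} (hm : 2 < m) (hcard : Nat.card M = 2 ^ m)
    (hp : IsPrimitiveDivisor m p) (P : Sylow p Mˣ) {k l : ℕ} (h2 : frob M k ≠ frob M l)
    (h3 : frob M k * frob M l ≠ 1) {F : M × M → M × M} (hZ : Z M k l ≤ CF (P : Subgroup Mˣ) k l F)
    (hF : IsZhouPott m k l F) :
    (CF (P : Subgroup Mˣ) k l F : Set (GLFF M)) = ⋃ ω ∈ F4Units M, Zω k l ω ∧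
      (Z M k l).relIndex (CF (P : Subgroup Mˣ) k l F) = 3 := by
  obtain ⟨hk0, -, hl0, hlm, hme, hk, d, hd, hF⟩ := hF
  have htwo : (2 : M) = 0 := (charTwo (M := M)).cast_eq_zero
  refine CF_eq_of_diagonal hm hme hcard hp P hk0 hk h2 h3 ?_ hZ (Or.inr one_ne_zero) (Or.inl rfl)
    ?_ ?_ ?_ (fun ω _ => by simp) hF
  · rw [Ne, frob_eq_one_iff hcard]
    exact Nat.not_dvd_of_pos_of_lt hl0 hlm
  · rintro rfl
    exact hd 0 0 (by rw [zero_pow (by positivity), zero_mul])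
  · intro e he
    obtain ⟨ω, hω3, hω1⟩ := exists_primitive_cube_root (M := M) hcard hme
    have e3 : (ω : M) ^ 3 = 1 := by rw [← Units.val_pow_eq_pow_val, hω3, Units.val_one]
    have n1 : (ω : M) - 1 ≠ 0 := fun h => hω1 (Units.ext (sub_eq_zero.1 h))
    have es : (ω : M) ^ 2 + ω + 1 = 0 := by
      refine (mul_eq_zero.1 (?_ : ((ω : M) - 1) * _ = 0)).resolve_left n1
      linear_combination e3
    have hpow : (ω : M) ^ 2 ^ k + ω = 1 := by
      obtain ⟨n, hn⟩ := three_dvd_two_pow_add_one (odd_of_gcd_eq_one hme hk)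
      have h : (ω : M) ^ 2 ^ k * ω = 1 := by rw [← pow_succ, hn, pow_mul, e3, one_pow]
      apply mul_right_cancel₀ ω.ne_zero
      linear_combination h + es - ω * htwo
    -- For a primitive cube root `ω` and odd `k`, `ω^q + ω = ω² + ω = 1`. With `b = ω` the Zhou–Pott
    -- condition says that `d` is no `(q+1)`-th power.
    refine hd e ω ?_
    rw [hpow, one_zpow, mul_one, he]
  · intro x y h
    simpa [twistedForm] using h

omit [Finite M] [Algebra (ZMod 2) M] in
-- Since `3 ∣ 2^n + 1` and `a^(2^n + 1) = a²`, the square of `a` is a cube, hence so is `a = a³ /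
-- a²`.
theorem isCube_of_mem_subfield {n : ℕ} (hn : Odd n) {a : M} (ha : a ^ 2 ^ n = a) :
    ∃ c, a = c ^ 3 := by
  by_cases h0 : a = 0
  · exact ⟨0, by simp [h0]⟩
  obtain ⟨j, hj⟩ := three_dvd_two_pow_add_one hn
  have h : (a ^ j) ^ 3 = a ^ 2 := by
    rw [← pow_mul, mul_comm, ← hj, pow_succ, ha, sq]
  refine ⟨a / a ^ j, ?_⟩
  rw [div_pow, h]
  field_simp

theorem CF_eq_of_isFamily4 {m p : ℕ} (hm : 2 < m) (hcard : Nat.card M = 2 ^ m)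
    (hp : IsPrimitiveDivisor m p) (P : Sylow p Mˣ) {k l : ℕ} (h2 : frob M k ≠ frob M l)
    (h3 : frob M k * frob M l ≠ 1) {F : M × M → M × M} (hZ : Z M k l ≤ CF (P : Subgroup Mˣ) k l F)
    (hF : IsFamily4 m k l F) :
    (CF (P : Subgroup Mˣ) k l F : Set (GLFF M)) = ⋃ ω ∈ F4Units M, Zω k l ω ∧
      (Z M k l).relIndex (CF (P : Subgroup Mˣ) k l F) = 3 := by
  obtain ⟨hk0, -, hm4, hk, hl, a, B, ha0, ha, hB0, hB, -, hF⟩ := hF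
  have htwo : (2 : M) = 0 := (charTwo (M := M)).cast_eq_zero
  have hme : Even m := Nat.even_iff.2 (by omega)
  have hkodd := odd_of_gcd_eq_one hme hk
  have hmodd : Odd (m / 2) := Nat.odd_iff.2 (by omega)
  -- So `r ≡ 1` modulo 3, and `ω^r = ω` for cube roots of unity.
  have hleven : Even l := hl ▸ hkodd.add_odd hmodd
  obtain ⟨n, hn⟩ := three_dvd_two_pow_sub_one hleven
  have hn' : 2 ^ l = 3 * n + 1 := by
    have : 0 < 2 ^ l := by positivity
    omega
  have hll : frob M l * frob M l ≠ 1 := by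
    have h := frob_mul_self_ne_one hm hcard hk
    rw [frob_mul, Ne, frob_eq_one_iff hcard] at h ⊢
    intro h'
    rw [show l + l = (k + k) + m by omega] at h'
    exact h ((Nat.dvd_add_left dvd_rfl).1 h')
  refine CF_eq_of_diagonal hm hme hcard hp P hk0 hk h2 h3 (fun h => hll (by rw [h, one_mul])) hZ
    (Or.inl one_ne_zero) (Or.inr (Or.inr hll)) hB0 ?_ ?_ ?_ hF
  · intro e he
    obtain ⟨j, hj⟩ := three_dvd_two_pow_add_one hkodd
    exact hB ⟨e ^ j, by rw [he, hj, ← pow_mul, mul_comm]⟩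
  -- A root off the axes gives `B = a (y/x)^(r-1)`. Both factors are cubes, but `B` is not.
  · intro x y h
    by_contra! hxy
    obtain ⟨hx, hy⟩ := hxy
    obtain ⟨c, hc⟩ := isCube_of_mem_subfield hmodd ha
    refine hB ⟨c * y ^ n / x ^ n, ?_⟩
    simp only [twistedForm, frob_apply, hn', zero_mul, zero_add, add_zero, one_mul] at h
    rw [div_pow, mul_pow, ← hc, div_eq_iff (pow_ne_zero _ (pow_ne_zero _ hx))]
    apply mul_right_cancel₀ (mul_ne_zero hx hy)
    have h' : B * (x ^ (3 * n + 1) * y) + a * (x * y ^ (3 * n + 1)) = 0 := by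
      field_simp at h
      linear_combination h
    rw [← pow_mul, ← pow_mul, mul_comm n 3]
    rw [pow_succ, pow_succ] at h'
    linear_combination -h' + a * (x * (y ^ (3 * n) * y)) * htwo
  · intro ω hω
    rw [hn', pow_succ, pow_mul, hω, one_pow, one_mul]

theorem CF_eq_of_isFamily12 {m p : ℕ} (hm : 2 < m) (hcard : Nat.card M = 2 ^ m)
    (hp : IsPrimitiveDivisor m p) (P : Sylow p Mˣ) {k l : ℕ} (h2 : frob M k ≠ frob M l)
    (h3 : frob M k * frob M l ≠ 1) {F : M × M → M × M} (hZ : Z M k l ≤ CF (P : Subgroup Mˣ) k l F)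
    (hF : IsFamily1 m k l F ∨ IsFamily2 m k l F) :
    (CF (P : Subgroup Mˣ) k l F : Set (GLFF M)) =
        (Z M k l : Set (GLFF M)) ∪ setA M k l ∪ setB M k l ∧
      (Z M k l).relIndex (CF (P : Subgroup Mˣ) k l F) = 3 := by
  have htwo : (2 : M) = 0 := (charTwo (M := M)).cast_eq_zero
  rcases hF with ⟨-, -, h3k, -, hF⟩ | ⟨-, -, h3k, -, hl, hF⟩
  · refine CF_eq_of_cubic_form hm hcard hp P h2 h3 hZ h3k (Or.inl one_ne_zero)
      (Or.inr (Or.inl rfl)) hF fun x y => ?_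
    simp only [biproj_eq_twistedForm, twistedForm, map_add]
    linear_combination (frob M l x * x + frob M l y * x) * htwo
  · refine CF_eq_of_cubic_form hm hcard hp P h2 h3 hZ h3k (Or.inl one_ne_zero)
      (Or.inr (Or.inr ?_)) hF fun x y => ?_
    · rw [hl]
      exact frob_mul_self_ne_one hm hcard h3k
    · simp only [biproj_eq_twistedForm, twistedForm, map_add]
      linear_combination (frob M l x * x) * htwo

omit [Finite M] in
theorem Zω_one (k l : ℕ) : (Zω k l 1 : Set (GLFF M)) = (Z M k l : Set (GLFF M)) := by
  ext T
  constructor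
  · rintro ⟨a, rfl⟩
    exact ⟨a, by simp [zHom]⟩
  · rintro ⟨a, rfl⟩
    exact ⟨a, by simp [zHom]⟩

end SpecialDiagonalFamilies

theorem mainTheorem9 {M : Type*} [Field M] [Finite M] [Algebra (ZMod 2) M]
    (m : ℕ) (hm : 2 < m) (hm6 : m ≠ 6) (hcard : Nat.card M = 2 ^ m)
    (p : ℕ) (hp : IsPrimitiveDivisor m p) (P : Sylow p Mˣ)
    (k l : ℕ) (hl0 : l ≠ 0) (hlm : 2 * l ≠ m)
    (hkl : ¬ (k : ℤ) ≡ (l : ℤ) [ZMOD (m : ℤ)]) (hkl' : ¬ (k : ℤ) ≡ -(l : ℤ) [ZMOD (m : ℤ)])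
    (F : M × M → M × M) (hF : IsBiprojectivePair k l F) :
    ((IsZhouPott m k l F ∨ IsFamily4 m k l F) →
      (CF (P : Subgroup Mˣ) k l F : Set (GLFF M)) = ⋃ ω ∈ F4Units M, Zω k l ω) ∧
    (Zω k l 1 : Set (GLFF M)) = (Z M k l : Set (GLFF M)) ∧
    (IsTaniguchi m k l F → CF (P : Subgroup Mˣ) k l F = Z M k l) ∧
    ((IsFamily1 m k l F ∨ IsFamily2 m k l F) →
      (CF (P : Subgroup Mˣ) k l F : Set (GLFF M)) =
        (Z M k l : Set (GLFF M)) ∪ setA M k l ∪ setB M k l) ∧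
    (Odd m → IsCarlet m k l F →
      Z M k l ≤ CF (P : Subgroup Mˣ) k l F ∧
        (Z M k l).relIndex (CF (P : Subgroup Mˣ) k l F) = 3) ∧
    ((IsZhouPott m k l F ∨ IsFamily4 m k l F ∨ IsTaniguchi m k l F ∨ IsFamily1 m k l F ∨
        IsFamily2 m k l F ∨ (Odd m ∧ IsCarlet m k l F)) →
      (CF (P : Subgroup Mˣ) k l F = Z M k l ∨
        (Z M k l ≤ CF (P : Subgroup Mˣ) k l F ∧
          (Z M k l).relIndex (CF (P : Subgroup Mˣ) k l F) = 3)) ∧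
      ConditionC p (P : Subgroup Mˣ) k l F) := by
  have hZ := Z_le_CF hF (P : Subgroup Mˣ)
  -- The two incongruences modulo `m` are exactly `φ ≠ ψ` and `φψ ≠ 1`.
  have h2 : frob M k ≠ frob M l := by
    rwa [Ne, frob_eq_frob_iff hcard, ← Int.natCast_modEq_iff]
  have h3 : frob M k * frob M l ≠ 1 := by
    rw [frob_mul, Ne, frob_eq_one_iff hcard, ← Int.natCast_dvd_natCast]
    intro h
    refine hkl' (Int.modEq_iff_dvd.2 ?_)
    rw [← dvd_neg]
    simpa [add_comm] using h
  have hdiag : (IsZhouPott m k l F ∨ IsFamily4 m k l F) → _ := fun h =>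
    h.elim (CF_eq_of_isZhouPott hm hcard hp P h2 h3 hZ) (CF_eq_of_isFamily4 hm hcard hp P h2 h3 hZ)
  have hcubic := CF_eq_of_isFamily12 (F := F) hm hcard hp P h2 h3 hZ
  have htan := CF_eq_Z_of_isTaniguchi (F := F) hm hcard hp P h2 h3 hZ
  have hcar := relIndex_of_isCarlet (F := F) hm hcard hp P hZ
  refine ⟨fun h => (hdiag h).1, Zω_one k l, htan, fun h => (hcubic h).1,
    fun _ h => ⟨hZ, hcar h⟩, fun h => ?_⟩
  have key : CF (P : Subgroup Mˣ) k l F = Z M k l ∨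
      (Z M k l ≤ CF (P : Subgroup Mˣ) k l F ∧
        (Z M k l).relIndex (CF (P : Subgroup Mˣ) k l F) = 3) := by
    rcases h with h | h | h | h | h | ⟨-, h⟩
    · exact Or.inr ⟨hZ, (hdiag (Or.inl h)).2⟩
    · exact Or.inr ⟨hZ, (hdiag (Or.inr h)).2⟩
    · exact Or.inl (htan h)
    · exact Or.inr ⟨hZ, (hcubic (Or.inl h)).2⟩
    · exact Or.inr ⟨hZ, (hcubic (Or.inr h)).2⟩
    · exact Or.inr ⟨hZ, hcar h⟩
  exact ⟨key, conditionC_of_index hm hp key⟩
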